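/- Links are tame oriented links in $S^3$ with ordered components, up to ambient isotopy. A link is trivial if its components bound pairwise disjoint (locally flat) disks. A link with $n\ge 1$ components is Brunnian if deleting any one of its components gives a trivial link. A link is $k$-trivial if it has a regular diagram with $k$ pairwise disjoint sets of crossings $S_1,\dots,S_k$ such that, for every nonempty $T\subseteq\{1,\dots,k\}$, changing all the crossings in $\bigcup_{i\in T}S_i$ gives a diagram of a trivial link. Theorem 1. Let $L$ be an $n$-component Brunnian link, $n\ge 1$. Then $L$ is $(n-1)$-trivial. Moreover, let $D$ be any regular diagram of $L$, and for $1\le i\le n$ let $S_i$ be the set of crossings of $D$ whose lower strand lies on the $i$-th component. Let $T$ be a nonempty proper subset of $\{1,\dots,n\}$, and let $D(T)$ be the diagram obtained from $D$ by changing all the crossings in $\bigcup_{i\in T}S_i$. Then at every crossing of $D(T)$ between a component with index in $T$ and a component with index not in $T$, the former is the upper strand; the link $L(T)$ with diagram $D(T)$ is the split union of an upper sublink (the components with index in $T$) and a lower sublink (the other components), that is, an ambient isotopy moves the former into the half space $z>0$ and the latter into $z<0$ of $\mathbb R^3\subset S^3$; and the upper sublink, the lower sublink and $L(T)$ itself are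 all trivial links. -/

import Mathlib

open Set Topology

/-- Euclidean 3-space. -/
abbrev E3 : Type := EuclideanSpace ℝ (Fin 3)

/-- The 3-sphere, as the one-point compactification of Euclidean 3-space. -/
abbrev S3 : Type := OnePoint E3

/-- An oriented link in the 3-sphere with components indexed by `ι`: pairwise disjoint simple
closed curves, each parametrized by (and oriented by the parametrization over) the circle `ℝ / ℤ`.
(For finite `ι` this is an embedding of a disjoint union of circles, by compactness.) -/
structure Link (ι : Type) where
  toFun : ι → UnitAddCircle → S3
  continuous_toFun : ∀ i, Continuous (toFun i)
  injective_toFun : Function.Injective fun p : ι × UnitAddCircle => toFun p.1 p.2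

/-- `c` is a closed polygon with the `m` (not necessarily distinct) vertices `c (j / m)`, and it is
parametrized affinely on each edge. -/
def IsPolygon {E : Type} [AddCommGroup E] [Module ℝ E] (c : UnitAddCircle → E) (m : ℕ) : Prop :=
  0 < m ∧ ∀ j : ℕ, ∀ s ∈ Icc (0 : ℝ) 1,
    c ((((j : ℝ) + s) / m : ℝ) : UnitAddCircle) =
      AffineMap.lineMap (c (((j : ℝ) / m : ℝ) : UnitAddCircle))
        (c ((((j : ℝ) + 1) / m : ℝ) : UnitAddCircle)) s

namespace Link

variable {ι : Type}

/-- Equivalence of links with ordered, oriented components: there is an ambient isotopy `H` of the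
3-sphere (a continuous path of self-homeomorphisms starting at the identity) whose end map takes
the `i`-th component of `L` to the `i`-th component of `L'`, preserving orientation (that is, up
to a reparametrization of the circle which lifts to an increasing bijection of the line). -/
def Isotopic (L L' : Link ι) : Prop :=
  ∃ H : unitInterval → (S3 ≃ₜ S3),
    (Continuous fun p : unitInterval × S3 => H p.1 p.2) ∧
    (∀ x, H 0 x = x) ∧
    ∀ i, ∃ f : ℝ ≃o ℝ, (∀ x, f (x + 1) = f x + 1) ∧
      ∀ x : ℝ, H 1 (L.toFun i (x : UnitAddCircle)) = L'.toFun i (f x : UnitAddCircle)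

/-- A link is tame if it is equivalent to a polygonal link in `ℝ³ ⊂ S³`. -/
def IsTame (L : Link ι) : Prop :=
  ∃ P : Link ι, L.Isotopic P ∧
    ∀ i, ∃ (c : UnitAddCircle → E3) (m : ℕ), IsPolygon c m ∧ ∀ x, P.toFun i x = (c x : S3)

/-- The sublink consisting of the components with index in `s`. -/
def sub (L : Link ι) (s : Set ι) : Link s where
  toFun i := L.toFun i
  continuous_toFun i := L.continuous_toFun i
  injective_toFun p q h := by
    have := L.injective_toFun (a₁ := ((p.1 : ι), p.2)) (a₂ := ((q.1 : ι), q.2)) h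
    simp only [Prod.mk.injEq] at this
    exact Prod.ext (Subtype.ext this.1) this.2

/-- A link is trivial if its components bound pairwise disjoint (locally flat) disks: the `i`-th
disk is the image of the flat unit disk under an open embedding `e i` of `ℝ³` in `S³`, and its
boundary, the image of the unit circle, is the `i`-th component. -/
def IsTrivial (L : Link ι) : Prop :=
  ∃ e : ι → E3 → S3,
    (∀ i, IsOpenEmbedding (e i)) ∧
    (∀ i, e i '' {v | v 2 = 0 ∧ ‖v‖ = 1} = range (L.toFun i)) ∧
    Pairwise fun i j =>
      Disjoint (e i '' {v | v 2 = 0 ∧ ‖v‖ ≤ 1}) (e j '' {v | v 2 = 0 ∧ ‖v‖ ≤ 1})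

/-- A link is Brunnian if deleting any one of its components gives a trivial link. -/
def IsBrunnian (L : Link ι) : Prop :=
  ∀ i, (L.sub {i}ᶜ).IsTrivial

/-- Up to isotopy, the components with index in `T` lie in the upper half space `z > 0` and the
other components lie in the lower half space `z < 0`. -/
def IsSplit (L : Link ι) (T : Set ι) : Prop :=
  ∃ L' : Link ι, L.Isotopic L' ∧
    (∀ i ∈ T, ∀ x, ∃ v : E3, L'.toFun i x = (v : S3) ∧ 0 < v 2) ∧
    (∀ i ∉ T, ∀ x, ∃ v : E3, L'.toFun i x = (v : S3) ∧ v 2 < 0)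

end Link

/-- A regular link diagram with components indexed by `ι`: closed oriented polygons in the plane
whose only multiple points are finitely many double points, none of them at a vertex (so that the
two strands cross transversally there), with the information which strand is the upper one.
Points of the strands are pairs `(i, x)`, where `x` is the parameter on the `i`-th polygon.
A crossing is a pair `(a, b)` of such points, with `a` on the upper and `b` on the lower strand. -/
structure Diagram (ι : Type) where
  curve : ι → UnitAddCircle → EuclideanSpace ℝ (Fin 2)
  edges : ι → ℕ
  crossings : Set ((ι × UnitAddCircle) × (ι × UnitAddCircle))
  continuous_curve : ∀ i, Continuous (curve i)
  polygon : ∀ i, IsPolygon (curve i) (edges i)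
  finite_crossings : crossings.Finite
  double_point : ∀ a b : ι × UnitAddCircle,
    (a ≠ b ∧ curve a.1 a.2 = curve b.1 b.2) ↔ ((a, b) ∈ crossings ∨ (b, a) ∈ crossings)
  asymm : ∀ a b, (a, b) ∈ crossings → (b, a) ∉ crossings
  no_triple_point : ∀ a b c : ι × UnitAddCircle, curve a.1 a.2 = curve b.1 b.2 →
    curve b.1 b.2 = curve c.1 c.2 → a = b ∨ b = c ∨ a = c
  not_vertex : ∀ c ∈ crossings, ∀ j : ℕ,
    c.1.2 ≠ (((j : ℝ) / edges c.1.1 : ℝ) : UnitAddCircle) ∧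
    c.2.2 ≠ (((j : ℝ) / edges c.2.1 : ℝ) : UnitAddCircle)

namespace Diagram

variable {ι : Type}

/-- Continuous heights for the points of the strands exist for which, at every crossing, the upper
strand is above the lower strand. -/
theorem exists_height (D : Diagram ι) : ∃ h : ι → UnitAddCircle → ℝ,
    (∀ i, Continuous (h i)) ∧ ∀ c ∈ D.crossings, h c.2.1 c.2.2 < h c.1.1 c.1.2 := by
  have key : ∀ i, ∃ f : C(UnitAddCircle, ℝ),
      EqOn f 0 {x | (i, x) ∈ Prod.snd '' D.crossings} ∧
      EqOn f 1 {x | (i, x) ∈ Prod.fst '' D.crossings} := by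
    intro i
    have hinj : ∀ s : Set (ι × UnitAddCircle), InjOn (fun x : UnitAddCircle => (i, x))
        ((fun x : UnitAddCircle => (i, x)) ⁻¹' s) := fun s x _ y _ h => (Prod.mk.inj h).2
    obtain ⟨f, h0, h1, -⟩ := exists_continuous_zero_one_of_isClosed
      (s := {x : UnitAddCircle | (i, x) ∈ Prod.snd '' D.crossings})
      (t := {x : UnitAddCircle | (i, x) ∈ Prod.fst '' D.crossings})
      ((D.finite_crossings.image _).preimage (hinj _)).isClosed
      ((D.finite_crossings.image _).preimage (hinj _)).isClosed
      (by
        rw [Set.disjoint_left]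
        rintro x ⟨⟨a, b⟩, hab, hx⟩ ⟨⟨c, d⟩, hcd, hx'⟩
        simp only at hx hx'
        subst hx
        subst hx'
        have e1 := (D.double_point _ _).2 (Or.inl hab)
        have e2 := (D.double_point _ _).2 (Or.inl hcd)
        rcases D.no_triple_point _ _ _ e1.2 e2.2 with h | h | h
        · exact e1.1 h
        · exact e2.1 h
        · subst h
          exact D.asymm _ _ hab hcd)
    exact ⟨f, h0, h1⟩
  choose f hf using key
  refine ⟨fun i => f i, fun i => (f i).continuous, fun c hc => ?_⟩
  have h0 := (hf c.2.1).1 (show c.2.2 ∈ _ from ⟨c, hc, rfl⟩)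
  have h1 := (hf c.1.1).2 (show c.1.2 ∈ _ from ⟨c, hc, rfl⟩)
  change f c.2.1 c.2.2 < f c.1.1 c.1.2
  rw [h0, h1]
  simp

/-- The heights of the strands in `Diagram.link`. Any two choices give isotopic links. -/
noncomputable def height (D : Diagram ι) : ι → UnitAddCircle → ℝ :=
  D.exists_height.choose

/-- The link with the given diagram: the strands are lifted from the plane to `ℝ³ ⊂ S³`, so that
at every crossing the upper strand is above the lower one. -/
noncomputable def link (D : Diagram ι) : Link ι where
  toFun i x := ((!₂[D.curve i x 0, D.curve i x 1, D.height i x] : E3) : S3)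
  continuous_toFun i := by
    have h1 := D.continuous_curve i
    have h2 : Continuous (D.height i) := D.exists_height.choose_spec.1 i
    refine OnePoint.continuous_coe.comp ((PiLp.continuous_toLp 2 _).comp ?_)
    refine continuous_pi fun k => ?_
    fin_cases k
    · exact (continuous_apply (0 : Fin 2)).comp ((PiLp.continuous_ofLp 2 (fun _ : Fin 2 => ℝ)).comp h1)
    · exact (continuous_apply (1 : Fin 2)).comp ((PiLp.continuous_ofLp 2 (fun _ : Fin 2 => ℝ)).comp h1)
    · exact h2
  injective_toFun p q h := by
    have h' := OnePoint.coe_injective h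
    have e0 := congrArg (fun v : E3 => v 0) h'
    have e1 := congrArg (fun v : E3 => v 1) h'
    have e2 := congrArg (fun v : E3 => v 2) h'
    simp at e0 e1 e2
    have hlt : ∀ c ∈ D.crossings, D.height c.2.1 c.2.2 < D.height c.1.1 c.1.2 :=
      D.exists_height.choose_spec.2
    by_contra hne
    have hc : D.curve p.1 p.2 = D.curve q.1 q.2 := by
      ext k
      fin_cases k
      · exact e0
      · exact e1
    rcases (D.double_point p q).1 ⟨hne, hc⟩ with hx | hx
    · exact absurd e2 (hlt _ hx).ne'
    · exact absurd e2 (hlt _ hx).ne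

/-- `D` is a diagram of the link `L`. -/
def IsDiagramOf (D : Diagram ι) (L : Link ι) : Prop :=
  D.link.Isotopic L

/-- The diagram obtained by changing all the crossings of `D` which belong to `S`, that is, by
interchanging their upper and lower strands. -/
def change (D : Diagram ι) (S : Set ((ι × UnitAddCircle) × (ι × UnitAddCircle))) : Diagram ι where
  curve := D.curve
  edges := D.edges
  crossings := {c | (c ∈ D.crossings ∧ c ∉ S) ∨ (c.swap ∈ D.crossings ∧ c.swap ∈ S)}
  continuous_curve := D.continuous_curve
  polygon := D.polygon
  finite_crossings := by
    refine (D.finite_crossings.union (D.finite_crossings.image Prod.swap)).subset ?_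
    rintro c (h | h)
    · exact Or.inl h.1
    · exact Or.inr ⟨c.swap, h.1, Prod.swap_swap c⟩
  double_point a b := by
    rw [D.double_point a b]
    simp only [mem_ofPred_eq, Prod.swap_prod_mk]
    tauto
  asymm a b := by
    have h1 := D.asymm a b
    have h2 := D.asymm b a
    simp only [mem_ofPred_eq, Prod.swap_prod_mk]
    tauto
  no_triple_point := D.no_triple_point
  not_vertex := by
    rintro c (h | h) j
    · exact D.not_vertex c h.1 j
    · exact (D.not_vertex c.swap h.1 j).symm

/-- The crossings of `D` whose lower strand lies on the `i`-th component. -/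
def underCrossings (D : Diagram ι) (i : ι) : Set ((ι × UnitAddCircle) × (ι × UnitAddCircle)) :=
  {c | c ∈ D.crossings ∧ c.2.1 = i}

end Diagram

/-- A link is `k`-trivial if it has a diagram with `k` pairwise disjoint sets of crossings such
that changing all crossings in the union of any nonempty subfamily gives a trivial link. -/
def Link.IsNTrivial {ι : Type} (L : Link ι) (k : ℕ) : Prop :=
  ∃ D : Diagram ι, D.IsDiagramOf L ∧
    ∃ S : Fin k → Set ((ι × UnitAddCircle) × (ι × UnitAddCircle)),
      (∀ j, S j ⊆ D.crossings) ∧ (Pairwise fun j l => Disjoint (S j) (S l)) ∧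
      ∀ T : Set (Fin k), T.Nonempty → (D.change (⋃ j ∈ T, S j)).link.IsTrivial

/-! A diagram has at most two strands over each point of the plane. Hence two lifts of the same
plane curves that order the strands alike at every crossing differ by a map that is affine on each
vertical line, with positive slope and a translation part depending continuously on the line
(`exists_vertical_affine`). Interpolating the coefficients with those of the identity makes this an
ambient isotopy (`Link.isotopic_map_verticalHomeo`). A negative slope gives a mirror image instead:
no longer an isotopy, but still a homeomorphism, and homeomorphisms preserve triviality.

In D(T) all crossings among the components in T are changed, so the upper sublink is the mirror
image of a sublink of L. The crossings among the other components are untouched, so the lower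
sublink is that of L. Both sublinks of L are proper, hence trivial because L is Brunnian. At mixed
crossings T is on top, so raising T and lowering the rest preserves the order at every crossing and
is an isotopy. Disks bounding each sublink can be kept away from infinity
(`Link.IsTrivial.exists_bounded_disks`), so a large shift makes the two families of disks disjoint
(`Link.exists_isTrivial_of_shift`).

For (n-1)-triviality the undercrossing sets of all components but one are used, so each union comes
from a proper T. This needs one diagram of L (`Link.exists_diagram`). The vertices of a polygonal
representative are moved horizontally into generic position. A small displacement of the polygon
extends to a Lipschitz vector field on space with constant less than one, and adding multiples of it
to the identity is an isotopy. -/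

/-! ### Isotopies and homeomorphisms of the 3-sphere -/

/-- A continuous family of homeomorphisms of `ℝ³`, with continuous family of inverses, extends
continuously to the 3-sphere. -/
theorem continuous_onePointCongr_family (H : unitInterval → E3 ≃ₜ E3)
    (hc : Continuous fun p : unitInterval × E3 => H p.1 p.2)
    (hs : Continuous fun p : unitInterval × E3 => (H p.1).symm p.2) :
    Continuous fun p : unitInterval × S3 => (H p.1).onePointCongr p.2 := by
  rw [continuous_iff_continuousAt]
  rintro ⟨t, x⟩
  induction x using OnePoint.rec with
  | coe x =>
    have hemb : IsOpenEmbedding (Prod.map id ((↑) : E3 → S3) :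
        unitInterval × E3 → unitInterval × S3) :=
      IsOpenEmbedding.id.prodMap OnePoint.isOpenEmbedding_coe
    have h : Continuous ((fun p : unitInterval × S3 => (H p.1).onePointCongr p.2) ∘
        (Prod.map id ((↑) : E3 → S3))) :=
      OnePoint.continuous_coe.comp hc
    exact (hemb.continuousAt_iff (x := (t, x))).1 h.continuousAt
  | infty =>
    rw [ContinuousAt]
    change Filter.Tendsto _ _ (𝓝 (OnePoint.infty : S3))
    rw [OnePoint.hasBasis_nhds_infty.tendsto_right_iff]
    rintro K ⟨-, hK⟩
    -- The union over all times of the preimages of `K` is compact; a point outside it is never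
    -- carried into `K`.
    have hcomp : IsCompact (Prod.snd '' ((fun p : unitInterval × E3 => (p.1, (H p.1).symm p.2)) ''
        (univ ×ˢ K))) :=
      ((isCompact_univ.prod hK).image (continuous_fst.prodMk hs)).image continuous_snd
    set K' := Prod.snd '' ((fun p : unitInterval × E3 => (p.1, (H p.1).symm p.2)) ''
        (univ ×ˢ K)) with hK'
    have hn : ((↑) '' K'ᶜ ∪ {OnePoint.infty} : Set S3) ∈ 𝓝 (OnePoint.infty : S3) :=
      OnePoint.hasBasis_nhds_infty.mem_of_mem ⟨hcomp.isClosed, hcomp⟩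
    rw [nhds_prod_eq]
    filter_upwards [Filter.prod_mem_prod Filter.univ_mem hn]
    rintro ⟨s, y⟩ ⟨-, hy⟩
    rcases hy with ⟨v, hv, rfl⟩ | hy
    · refine Or.inl ⟨H s v, fun hmem => hv ?_, rfl⟩
      exact ⟨(s, v), ⟨(s, H s v), ⟨mem_univ _, hmem⟩, by simp⟩, rfl⟩
    · obtain rfl : y = OnePoint.infty := hy
      exact Or.inr rfl

namespace Link

variable {ι : Type}

/-- The image of a link under a homeomorphism of the 3-sphere. -/
def map (g : S3 ≃ₜ S3) (L : Link ι) : Link ι where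
  toFun i x := g (L.toFun i x)
  continuous_toFun i := g.continuous.comp (L.continuous_toFun i)
  injective_toFun := g.injective.comp L.injective_toFun

theorem isotopic_map (L : Link ι) (H : unitInterval → E3 ≃ₜ E3)
    (hc : Continuous fun p : unitInterval × E3 => H p.1 p.2)
    (hs : Continuous fun p : unitInterval × E3 => (H p.1).symm p.2) (h0 : ∀ x, H 0 x = x) :
    L.Isotopic (L.map (H 1).onePointCongr) := by
  refine ⟨fun t => (H t).onePointCongr, continuous_onePointCongr_family H hc hs, fun x => ?_,
    fun i => ⟨OrderIso.refl ℝ, fun x => rfl, fun x => rfl⟩⟩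
  induction x using OnePoint.rec with
  | coe x => exact congrArg _ (h0 x)
  | infty => rfl

theorem Isotopic.trans {L L' L'' : Link ι} (h : L.Isotopic L') (h' : L'.Isotopic L'') :
    L.Isotopic L'' := by
  obtain ⟨H, hc, h0, hf⟩ := h
  obtain ⟨K, kc, k0, kf⟩ := h'
  refine ⟨fun t => (H t).trans (K t), ?_, fun x => ?_, fun i => ?_⟩
  · exact kc.comp (continuous_fst.prodMk hc)
  · simp [h0, k0]
  · obtain ⟨f, f1, f2⟩ := hf i
    obtain ⟨g, g1, g2⟩ := kf i
    refine ⟨f.trans g, fun x => ?_, fun x => ?_⟩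
    · simp [f1, g1]
    · simp [f2, g2]

theorem Isotopic.symm {L L' : Link ι} (h : L.Isotopic L') : L'.Isotopic L := by
  obtain ⟨H, hc, h0, hf⟩ := h
  refine ⟨fun t => (H t).symm, ?_, fun x => ?_, fun i => ?_⟩
  · let e : unitInterval × S3 ≃ unitInterval × S3 :=
      { toFun := fun p => (p.1, H p.1 p.2)
        invFun := fun p => (p.1, (H p.1).symm p.2)
        left_inv := fun p => by simp
        right_inv := fun p => by simp }
    -- The level-preserving map is a continuous bijection of a compact Hausdorff space, which makes
    -- the inverses jointly continuous.
    have he : Continuous e := continuous_fst.prodMk hc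
    exact continuous_snd.comp (Continuous.homeoOfEquivCompactToT2 (f := e) he).symm.continuous
  · rw [Homeomorph.symm_apply_eq, h0]
  · obtain ⟨f, f1, f2⟩ := hf i
    refine ⟨f.symm, fun x => ?_, fun x => ?_⟩
    · rw [OrderIso.symm_apply_eq, f1, OrderIso.apply_symm_apply]
    · rw [Homeomorph.symm_apply_eq, f2, OrderIso.apply_symm_apply]

/-- Isotopic links are related by a homeomorphism of the 3-sphere. -/
theorem Isotopic.exists_homeomorph {L L' : Link ι} (h : L.Isotopic L') :
    ∃ g : S3 ≃ₜ S3, ∀ i, g '' range (L.toFun i) = range (L'.toFun i) := by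
  obtain ⟨H, hc, h0, hf⟩ := h
  refine ⟨H 1, fun i => ?_⟩
  obtain ⟨f, f1, f2⟩ := hf i
  have hq : Function.Surjective ((↑) : ℝ → UnitAddCircle) := QuotientAddGroup.mk_surjective
  rw [← range_comp]
  calc range (H 1 ∘ L.toFun i)
      = range ((H 1 ∘ L.toFun i) ∘ ((↑) : ℝ → UnitAddCircle)) := (hq.range_comp _).symm
    _ = range ((L'.toFun i ∘ ((↑) : ℝ → UnitAddCircle)) ∘ f) := congrArg range (funext f2)
    _ = range (L'.toFun i ∘ ((↑) : ℝ → UnitAddCircle)) := f.surjective.range_comp _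
    _ = range (L'.toFun i) := hq.range_comp _

/-- Disks are carried along by `g`. No isotopy is required, so orientation-reversing maps are
allowed; this is what handles mirror images. -/
theorem IsTrivial.of_homeomorph {L L' : Link ι} (h : L.IsTrivial) (g : S3 ≃ₜ S3)
    (hg : ∀ i, g '' range (L.toFun i) = range (L'.toFun i)) : L'.IsTrivial := by
  obtain ⟨e, he, hr, hd⟩ := h
  refine ⟨fun i => g ∘ e i, fun i => g.isOpenEmbedding.comp (he i), fun i => ?_,
    fun i j hij => ?_⟩
  · rw [image_comp, hr, hg]
  · change Disjoint _ _
    rw [image_comp, image_comp, disjoint_image_iff g.injective]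
    exact hd hij

theorem IsTrivial.sub_of_subset {L : Link ι} {s t : Set ι} (h : (L.sub t).IsTrivial)
    (hst : s ⊆ t) : (L.sub s).IsTrivial := by
  obtain ⟨e, he, hr, hd⟩ := h
  exact ⟨fun i => e ⟨i, hst i.2⟩, fun i => he _, fun i => hr ⟨i, hst i.2⟩,
    fun i j hij => hd fun h => hij (Subtype.ext (congrArg Subtype.val h :))⟩

end Link

/-! ### Vertical affine maps -/

/-- The projection of space to the plane. -/
def planeProj (v : E3) : EuclideanSpace ℝ (Fin 2) := !₂[v 0, v 1]

/-- The point of space over a point of the plane, with given height. -/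
def spacePoint (p : EuclideanSpace ℝ (Fin 2)) (z : ℝ) : E3 := !₂[p 0, p 1, z]

theorem continuous_planeProj : Continuous planeProj := by
  unfold planeProj
  fun_prop

theorem continuous_spacePoint :
    Continuous fun q : EuclideanSpace ℝ (Fin 2) × ℝ => spacePoint q.1 q.2 := by
  unfold spacePoint
  fun_prop

@[simp] theorem planeProj_spacePoint (p : EuclideanSpace ℝ (Fin 2)) (z : ℝ) :
    planeProj (spacePoint p z) = p := by
  ext k
  fin_cases k <;> rfl

@[simp] theorem spacePoint_two (p : EuclideanSpace ℝ (Fin 2)) (z : ℝ) : spacePoint p z 2 = z := rfl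

@[simp] theorem spacePoint_planeProj (v : E3) : spacePoint (planeProj v) (v 2) = v := by
  ext k
  fin_cases k <;> rfl

/-- The homeomorphism of space which preserves the vertical lines and is affine on each of them. -/
noncomputable def verticalHomeo (lam phi : EuclideanSpace ℝ (Fin 2) → ℝ) (hl : Continuous lam)
    (hp : Continuous phi) (h0 : ∀ p, lam p ≠ 0) : E3 ≃ₜ E3 where
  toFun v := spacePoint (planeProj v) (lam (planeProj v) * v 2 + phi (planeProj v))
  invFun v := spacePoint (planeProj v) ((v 2 - phi (planeProj v)) / lam (planeProj v))
  left_inv v := by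
    have := h0 (planeProj v)
    simp only [planeProj_spacePoint, spacePoint_two]
    rw [add_sub_cancel_right, mul_div_cancel_left₀ _ this, spacePoint_planeProj]
  right_inv v := by
    have := h0 (planeProj v)
    simp only [planeProj_spacePoint, spacePoint_two]
    rw [mul_div_cancel₀ _ this, sub_add_cancel, spacePoint_planeProj]
  continuous_toFun := by
    have := continuous_planeProj
    exact continuous_spacePoint.comp (this.prodMk (by fun_prop))
  continuous_invFun := by
    have := continuous_planeProj
    refine continuous_spacePoint.comp (this.prodMk (Continuous.div ?_ ?_ fun v => h0 _)) <;> fun_prop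

theorem verticalHomeo_spacePoint (lam phi : EuclideanSpace ℝ (Fin 2) → ℝ) (hl : Continuous lam)
    (hp : Continuous phi) (h0 : ∀ p, lam p ≠ 0) (p : EuclideanSpace ℝ (Fin 2)) (z : ℝ) :
    verticalHomeo lam phi hl hp h0 (spacePoint p z) = spacePoint p (lam p * z + phi p) := by
  simp [verticalHomeo]

/-- Positive slopes form a convex set, so the straight-line path of coefficients from the identity
stays within homeomorphisms. -/
theorem Link.isotopic_map_verticalHomeo {ι : Type} (L : Link ι)
    (lam phi : EuclideanSpace ℝ (Fin 2) → ℝ) (hl : Continuous lam)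
    (hp : Continuous phi) (h0 : ∀ p, 0 < lam p) :
    L.Isotopic (L.map (verticalHomeo lam phi hl hp fun p => (h0 p).ne').onePointCongr) := by
  have hpos : ∀ (t : unitInterval) p, 0 < 1 - (t : ℝ) + t * lam p := fun t p => by
    rcases t.2.2.lt_or_eq with h | h
    · have := mul_nonneg t.2.1 (h0 p).le
      linarith
    · rw [h]
      simpa using h0 p
  have hpp := continuous_planeProj
  let H : unitInterval → E3 ≃ₜ E3 := fun t => verticalHomeo (fun p => 1 - (t : ℝ) + t * lam p)
    (fun p => t * phi p) (by fun_prop) (by fun_prop) fun p => (hpos t p).ne'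
  have key := L.isotopic_map H ?_ ?_ ?_
  · convert key using 3
    ext v k
    simp [H, verticalHomeo]
  · refine continuous_spacePoint.comp (Continuous.prodMk (by fun_prop) ?_)
    fun_prop
  · refine continuous_spacePoint.comp (Continuous.prodMk (by fun_prop) ?_)
    refine Continuous.div ?_ ?_ fun v => (hpos _ _).ne' <;> fun_prop
  · intro v
    simp [H, verticalHomeo]

/-- Two systems of heights over the same plane curves, which order the strands over each of the
finitely many double points in the same way, differ by a map which is affine on vertical lines. -/
theorem exists_vertical_affine {ι : Type} [Finite ι]
    (γ : ι → UnitAddCircle → EuclideanSpace ℝ (Fin 2)) (h h' : ι → UnitAddCircle → ℝ)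
    (hγ : ∀ i, Continuous (γ i)) (hh : ∀ i, Continuous (h i)) (hh' : ∀ i, Continuous (h' i))
    (hfin : {a : ι × UnitAddCircle | ∃ b, a ≠ b ∧ γ a.1 a.2 = γ b.1 b.2}.Finite)
    (htriple : ∀ a b c : ι × UnitAddCircle, γ a.1 a.2 = γ b.1 b.2 →
      γ b.1 b.2 = γ c.1 c.2 → a = b ∨ b = c ∨ a = c)
    (hord : ∀ a b : ι × UnitAddCircle, a ≠ b → γ a.1 a.2 = γ b.1 b.2 →
      0 < (h a.1 a.2 - h b.1 b.2) * (h' a.1 a.2 - h' b.1 b.2)) :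
    ∃ lam phi : EuclideanSpace ℝ (Fin 2) → ℝ, Continuous lam ∧ Continuous phi ∧ (∀ p, 0 < lam p) ∧
      ∀ i x, h' i x = lam (γ i x) * h i x + phi (γ i x) := by
  classical
  let _ : TopologicalSpace ι := ⊥
  have _ : DiscreteTopology ι := ⟨rfl⟩
  have hr : ∀ q, ∃ r : ℝ, 0 < r ∧ ∀ a b : ι × UnitAddCircle, γ a.1 a.2 = q → γ b.1 b.2 = q →
      r * (h a.1 a.2 - h b.1 b.2) = h' a.1 a.2 - h' b.1 b.2 := by
    intro q
    by_cases hq : ∃ a b : ι × UnitAddCircle, a ≠ b ∧ γ a.1 a.2 = q ∧ γ b.1 b.2 = q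
    · obtain ⟨a, b, hab, ha, hb⟩ := hq
      have ho := hord a b hab (ha.trans hb.symm)
      have hne : h a.1 a.2 - h b.1 b.2 ≠ 0 := left_ne_zero_of_mul ho.ne'
      have hcase : ∀ c : ι × UnitAddCircle, γ c.1 c.2 = q → c = a ∨ c = b := fun c hc => by
        rcases htriple a b c (ha.trans hb.symm) (hb.trans hc.symm) with e | e | e
        · exact absurd e hab
        · exact Or.inr e.symm
        · exact Or.inl e.symm
      -- Over a double point the slope is forced: it is the ratio of the height differences,
      -- positive since both systems order the strands alike.
      refine ⟨(h' a.1 a.2 - h' b.1 b.2) / (h a.1 a.2 - h b.1 b.2), ?_, fun c d hc hd => ?_⟩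
      · have : (h' a.1 a.2 - h' b.1 b.2) / (h a.1 a.2 - h b.1 b.2) =
            (h a.1 a.2 - h b.1 b.2) * (h' a.1 a.2 - h' b.1 b.2) / (h a.1 a.2 - h b.1 b.2) ^ 2 := by
          field_simp
        rw [this]
        positivity
      · rcases hcase c hc with rfl | rfl <;> rcases hcase d hd with rfl | rfl
        · simp
        · field_simp
        · field_simp
          ring
        · simp
    · push Not at hq
      refine ⟨1, one_pos, fun a b ha hb => ?_⟩
      by_cases hab : a = b
      · subst hab; simp
      · exact absurd hb (hq a b hab ha)
  choose r hr0 hr using hr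
  set A := {a : ι × UnitAddCircle | ∃ b, a ≠ b ∧ γ a.1 a.2 = γ b.1 b.2} with hA
  set Q := (fun a : ι × UnitAddCircle => γ a.1 a.2) '' A with hQ
  have hQf : Q.Finite := hfin.image _
  have : Finite Q := hQf
  -- Tietze extension is applied to the logarithm of the slope, so that the exponential of the
  -- extension is positive everywhere.
  obtain ⟨g, hg⟩ := ContinuousMap.exists_restrict_eq hQf.isClosed
    (⟨fun q => Real.log (r q), continuous_of_discreteTopology⟩ : C(Q, ℝ))
  have hgr : ∀ q ∈ Q, Real.exp (g q) = r q := fun q hq => by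
    have : g q = Real.log (r q) := congrArg (fun f : C(Q, ℝ) => f ⟨q, hq⟩) hg
    rw [this, Real.exp_log (hr0 q)]
  have hcurry : ∀ {Y : Type} [TopologicalSpace Y] (f : ι → UnitAddCircle → Y),
      (∀ i, Continuous (f i)) → Continuous fun a : ι × UnitAddCircle => f a.1 a.2 :=
    fun f hf => continuous_prod_of_discrete_left.2 hf
  have hγ' := hcurry γ hγ
  let Γ : ι × UnitAddCircle → EuclideanSpace ℝ (Fin 2) := fun a => γ a.1 a.2
  let Γ' : C(ι × UnitAddCircle, range Γ) := ⟨rangeFactorization Γ, hγ'.subtype_mk _⟩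
  have hΓ : IsQuotientMap Γ' :=
    (hγ'.subtype_mk _).isClosedMap.isQuotientMap (hγ'.subtype_mk _) rangeFactorization_surjective
  let u : C(ι × UnitAddCircle, ℝ) :=
    ⟨fun a => h' a.1 a.2 - Real.exp (g (γ a.1 a.2)) * h a.1 a.2, by
      have := hcurry h hh
      have := hcurry h' hh'
      fun_prop⟩
  -- Once the slope is fixed, `u` is the translation part required on the strands. The slope at
  -- double points makes it agree on both strands, so it descends to the image of the curves and
  -- extends by Tietze.
  have hfac : Function.FactorsThrough u Γ' := by
    intro a b hab
    have hab : γ a.1 a.2 = γ b.1 b.2 := congrArg Subtype.val hab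
    by_cases hne : a = b
    · rw [hne]
    · have hq : γ b.1 b.2 ∈ Q := ⟨a, ⟨b, hne, hab⟩, hab⟩
      have := hr _ a b hab rfl
      simp only [u, ContinuousMap.coe_mk, hab, hgr _ hq]
      linarith
  obtain ⟨φ, hφ⟩ := ContinuousMap.exists_restrict_eq (isCompact_range hγ').isClosed
    (hΓ.lift u hfac)
  refine ⟨fun q => Real.exp (g q), φ, by fun_prop, φ.continuous, fun p => Real.exp_pos _,
    fun i x => ?_⟩
  have e1 : φ (γ i x) = hΓ.lift u hfac (Γ' (i, x)) :=
    congrArg (fun f : C(range Γ, ℝ) => f (Γ' (i, x))) hφ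
  have e2 := congrArg (fun f : C(ι × UnitAddCircle, ℝ) => f (i, x)) (hΓ.lift_comp u hfac)
  have e3 : hΓ.lift u hfac (Γ' (i, x)) =
      h' i x - Real.exp (g (γ i x)) * h i x := e2
  rw [e1, e3]
  ring

/-! ### Keeping disks away from infinity -/

open NNReal in
/-- A Lipschitz perturbation of the identity, with constant less than one, is a homeomorphism. -/
theorem exists_homeomorph_add_lipschitz {E : Type*} [NormedAddCommGroup E] [NormedSpace ℝ E]
    [CompleteSpace E] {δ : E → E} {K : ℝ≥0} (hK : K < 1) (h : LipschitzWith K δ) :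
    ∃ g : E ≃ₜ E, ∀ x, g x = x + δ x := by
  have ha : ApproximatesLinearOn (fun x => x + δ x)
      ((ContinuousLinearEquiv.refl ℝ E : E ≃L[ℝ] E) : E →L[ℝ] E) univ K := by
    refine LipschitzOnWith.approximatesLinearOn ?_
    convert h.lipschitzOnWith (s := univ) using 1
    ext x
    simp
  refine ⟨ha.toHomeomorph _ ?_, fun x => rfl⟩
  by_cases hs : Subsingleton E
  · exact Or.inl hs
  · right
    rw [not_subsingleton_iff_nontrivial] at hs
    refine hK.trans_eq ?_
    have : ‖(ContinuousLinearEquiv.refl ℝ E).symm.toContinuousLinearMap‖₊ = 1 :=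
      ContinuousLinearMap.nnnorm_id
    rw [this, inv_one]

/-- Nearby points can be moved to each other by a homeomorphism supported in a given ball. -/
theorem exists_homeomorph_ball_move {q p : E3} {r : ℝ} (hr : 0 < r) (hpq : dist p q < r / 3) :
    ∃ g : E3 ≃ₜ E3, g p = q ∧ ∀ x ∉ Metric.ball q r, g x = x := by
  -- A cone of height one and radius `r / 2` about `p`. Its support lies in the ball about `q` since
  -- `r / 2 + r / 3 < r`, and the Lipschitz constant of the displacement is below `2 / 3`.
  let β : E3 → ℝ := fun x => max (1 - dist x p / (r / 2)) 0
  let K : NNReal := ⟨dist p q / (r / 2), by positivity⟩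
  have hK : K < 1 := by
    rw [← NNReal.coe_lt_coe]
    change dist p q / (r / 2) < 1
    rw [div_lt_one (by positivity)]
    linarith
  have hlip : LipschitzWith K fun x => β x • (q - p) := by
    refine LipschitzWith.of_dist_le_mul fun x y => ?_
    have h1 : |β x - β y| ≤ dist x y / (r / 2) := by
      refine (abs_max_sub_max_le_abs _ _ _).trans ?_
      rw [show 1 - dist x p / (r / 2) - (1 - dist y p / (r / 2)) =
        (dist y p - dist x p) / (r / 2) by ring, abs_div, abs_of_pos (half_pos hr)]
      gcongr
      rw [dist_comm x y]
      exact abs_dist_sub_le _ _ _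
    rw [dist_eq_norm, ← sub_smul, norm_smul, Real.norm_eq_abs, ← dist_eq_norm, dist_comm q p]
    calc |β x - β y| * dist p q ≤ dist x y / (r / 2) * dist p q := by gcongr
      _ = dist p q / (r / 2) * dist x y := by ring
  obtain ⟨g, hg⟩ := exists_homeomorph_add_lipschitz hK hlip
  refine ⟨g, ?_, fun x hx => ?_⟩
  · rw [hg]
    simp [β]
  · have h1 : r ≤ dist x q := not_lt.1 hx
    have h2 := dist_triangle x p q
    have : β x = 0 := by
      refine max_eq_right ?_
      rw [sub_nonpos, le_div_iff₀ (half_pos hr)]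
      linarith
    rw [hg, this, zero_smul, add_zero]

/-- The antipodal map of the round sphere has no fixed point. -/
theorem exists_homeomorph_infty_ne : ∃ g : S3 ≃ₜ S3, g OnePoint.infty ≠ OnePoint.infty := by
  let s : S3 ≃ₜ Metric.sphere (0 : EuclideanSpace ℝ (Fin 4)) 1 :=
    onePointEquivSphereOfFinrankEq (by simp)
  refine ⟨(s.trans (Homeomorph.neg _)).trans s.symm, fun h => ?_⟩
  have h' : -s OnePoint.infty = s OnePoint.infty := by
    have := congrArg s h
    simpa using this
  have h2 := congrArg Subtype.val h'
  have h3 : ((s OnePoint.infty : Metric.sphere _ _) : EuclideanSpace ℝ (Fin 4)) = 0 := by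
    rw [coe_neg_sphere] at h2
    ext k
    have := congrArg (fun v : EuclideanSpace ℝ (Fin 4) => v k) h2
    simp only [PiLp.neg_apply] at this
    simp only [PiLp.zero_apply]
    linarith
  have h4 := (s OnePoint.infty).2
  rw [h3] at h4
  simp at h4

/-- The point at infinity can be moved to a dense set by a homeomorphism fixing a closed set. -/
theorem exists_homeomorph_infty_moved {K V : Set S3} (hK : IsClosed K) (hinf : OnePoint.infty ∉ K)
    (hV : Dense V) : ∃ g : S3 ≃ₜ S3, (∀ x ∈ K, g x = x) ∧ ∃ p ∈ V, g p = OnePoint.infty := by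
  -- Conjugation by `σ` brings infinity to a finite point `q`. A nearby point `p` of the image of
  -- `V` is then pushed to `q` inside a ball that misses the image of `K`.
  obtain ⟨σ, hσ⟩ := exists_homeomorph_infty_ne
  obtain ⟨q, hq⟩ := OnePoint.ne_infty_iff_exists.1 hσ
  have hopen : IsOpen ((↑) ⁻¹' (σ.symm ⁻¹' Kᶜ) : Set E3) :=
    (hK.isOpen_compl.preimage σ.symm.continuous).preimage OnePoint.continuous_coe
  have hmem : q ∈ ((↑) ⁻¹' (σ.symm ⁻¹' Kᶜ) : Set E3) := by
    change σ.symm (q : S3) ∈ Kᶜ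
    rw [hq, Homeomorph.symm_apply_apply]
    exact hinf
  obtain ⟨r, hr, hball⟩ := Metric.isOpen_iff.1 hopen q hmem
  have hdense : Dense ((fun v : E3 => σ.symm (v : S3)) ⁻¹' V) :=
    hV.preimage (σ.symm.isOpenMap.comp OnePoint.isOpenMap_coe)
  obtain ⟨p, hp, hpq⟩ := Metric.dense_iff.1 hdense q (r / 3) (by positivity)
  obtain ⟨b, hb, hbfix⟩ := exists_homeomorph_ball_move hr hp
  refine ⟨(σ.trans b.onePointCongr).trans σ.symm, fun x hx => ?_, σ.symm p, hpq, ?_⟩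
  · simp only [Homeomorph.trans_apply]
    rw [Homeomorph.symm_apply_eq]
    by_cases hx' : σ x = OnePoint.infty
    · rw [hx']; rfl
    · obtain ⟨v, hv⟩ := OnePoint.ne_infty_iff_exists.1 hx'
      rw [← hv]
      refine congrArg OnePoint.some (hbfix v fun hv' => ?_)
      have := hball hv'
      simp only [mem_preimage, hv, Homeomorph.symm_apply_apply] at this
      exact this hx
  · simp only [Homeomorph.trans_apply, Homeomorph.apply_symm_apply]
    rw [Homeomorph.symm_apply_eq, ← hq]
    exact congrArg OnePoint.some hb

theorem isCompact_flatDisk : IsCompact {v : E3 | v 2 = 0 ∧ ‖v‖ ≤ 1} := by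
  refine (isCompact_closedBall (0 : E3) 1).of_isClosed_subset ?_ fun v hv => by simpa using hv.2
  exact (isClosed_eq (by fun_prop) continuous_const).inter
    (isClosed_le continuous_norm continuous_const)

/-- In the chart, any point of the disk leaves it under an arbitrarily small vertical push. -/
theorem dense_compl_image_flatDisk {e : E3 → S3} (he : IsOpenEmbedding e) :
    Dense (e '' {v : E3 | v 2 = 0 ∧ ‖v‖ ≤ 1})ᶜ := by
  rw [← interior_eq_empty_iff_dense_compl, eq_empty_iff_forall_notMem]
  intro y hy
  obtain ⟨v, hv, rfl⟩ := interior_subset hy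
  have hU : IsOpen (e ⁻¹' interior (e '' {v : E3 | v 2 = 0 ∧ ‖v‖ ≤ 1})) :=
    isOpen_interior.preimage he.continuous
  obtain ⟨r, hr, hball⟩ := Metric.isOpen_iff.1 hU v hy
  have hmem : v + EuclideanSpace.single 2 (r / 2) ∈ Metric.ball v r := by
    simp [abs_of_pos hr, hr]
  obtain ⟨w, hw, hwe⟩ := interior_subset (hball hmem)
  have h2 := congrArg (fun u : E3 => u 2) (he.injective hwe)
  simp [hw.1, hv.1] at h2
  linarith

namespace Link

variable {ι : Type}

/-- A trivial link in `ℝ³` bounds disjoint disks in `ℝ³`. -/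
theorem IsTrivial.exists_bounded_disks [Finite ι] {L : Link ι} (h : L.IsTrivial)
    (hL : ∀ i x, L.toFun i x ≠ OnePoint.infty) :
    ∃ e : ι → E3 → S3, (∀ i, IsOpenEmbedding (e i)) ∧
      (∀ i, e i '' {v | v 2 = 0 ∧ ‖v‖ = 1} = range (L.toFun i)) ∧
      (Pairwise fun i j =>
        Disjoint (e i '' {v | v 2 = 0 ∧ ‖v‖ ≤ 1}) (e j '' {v | v 2 = 0 ∧ ‖v‖ ≤ 1})) ∧
      ∃ R : ℝ, ∀ i, e i '' {v | v 2 = 0 ∧ ‖v‖ ≤ 1} ⊆ (↑) '' Metric.ball (0 : E3) R := by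
  obtain ⟨e, he, hr, hd⟩ := h
  have hKc : IsClosed (⋃ i, range (L.toFun i)) :=
    isClosed_iUnion_of_finite fun i => (isCompact_range (L.continuous_toFun i)).isClosed
  have hcD : ∀ i, IsCompact (e i '' {v : E3 | v 2 = 0 ∧ ‖v‖ ≤ 1}) := fun i =>
    isCompact_flatDisk.image (he i).continuous
  have hV : Dense (⋂ i, (e i '' {v : E3 | v 2 = 0 ∧ ‖v‖ ≤ 1})ᶜ) :=
    dense_iInter_of_isOpen (fun i => (hcD i).isClosed.isOpen_compl)
      fun i => dense_compl_image_flatDisk (he i)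
  -- A point off all the disks is sent to infinity while the link is fixed; the images of the disks
  -- then miss infinity and are bounded by compactness.
  obtain ⟨g, hg, p, hp, hgp⟩ := exists_homeomorph_infty_moved hKc
    (by simpa using fun i x => hL i x) hV
  have hnot : ∀ i, OnePoint.infty ∉ (g ∘ e i) '' {v : E3 | v 2 = 0 ∧ ‖v‖ ≤ 1} := by
    intro i hi
    rw [image_comp] at hi
    obtain ⟨y, hy, hyi⟩ := hi
    rw [← hgp] at hyi
    obtain rfl := g.injective hyi
    exact mem_iInter.1 hp i hy
  have hc : IsCompact (⋃ i, (g ∘ e i) '' {v : E3 | v 2 = 0 ∧ ‖v‖ ≤ 1}) :=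
    isCompact_iUnion fun i => isCompact_flatDisk.image (g.continuous.comp (he i).continuous)
  have hc' : IsCompact ((↑) ⁻¹' (⋃ i, (g ∘ e i) '' {v : E3 | v 2 = 0 ∧ ‖v‖ ≤ 1}) : Set E3) := by
    refine OnePoint.isOpenEmbedding_coe.isInducing.isCompact_preimage' hc ?_
    rintro y hy
    obtain ⟨i, hi⟩ := mem_iUnion.1 hy
    rcases eq_or_ne y OnePoint.infty with rfl | hne
    · exact absurd hi (hnot i)
    · exact OnePoint.ne_infty_iff_exists.1 hne
  obtain ⟨R, hR⟩ := hc'.isBounded.subset_ball (0 : E3)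
  refine ⟨fun i => g ∘ e i, fun i => g.isOpenEmbedding.comp (he i), fun i => ?_,
    fun i j hij => ?_, R, fun i y hy => ?_⟩
  · rw [image_comp, hr]
    have : ∀ x, g (L.toFun i x) = L.toFun i x := fun x => hg _ (mem_iUnion.2 ⟨i, x, rfl⟩)
    rw [← range_comp]
    exact congrArg range (funext this)
  · change Disjoint _ _
    rw [image_comp, image_comp, disjoint_image_iff g.injective]
    exact hd hij
  · rcases eq_or_ne y OnePoint.infty with rfl | hne
    · exact absurd hy (hnot i)
    · obtain ⟨v, rfl⟩ := OnePoint.ne_infty_iff_exists.1 hne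
      exact ⟨v, hR (mem_iUnion.2 ⟨i, hy⟩), rfl⟩

/-! ### Vertical separation and changed diagrams -/

/-- The vertical translation of the 3-sphere. -/
noncomputable def verticalShift (M : ℝ) : S3 ≃ₜ S3 :=
  (Homeomorph.addRight (EuclideanSpace.single 2 M : E3)).onePointCongr

theorem verticalShift_coe (M : ℝ) (v : E3) :
    verticalShift M (v : S3) = ((v + EuclideanSpace.single 2 M : E3) : S3) := rfl

/-- If two complementary trivial sublinks are moved far apart vertically, then the resulting link
is trivial. -/
theorem exists_isTrivial_of_shift [Finite ι] {L : Link ι} {T : Set ι} (hT : (L.sub T).IsTrivial)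
    (hT' : (L.sub Tᶜ).IsTrivial) (hL : ∀ i x, L.toFun i x ≠ OnePoint.infty) :
    ∃ M₀ : ℝ, ∀ M, M₀ ≤ M → ∀ L' : Link ι,
      (∀ i ∈ T, ∀ x, L'.toFun i x = verticalShift M (L.toFun i x)) →
      (∀ i ∉ T, ∀ x, L'.toFun i x = verticalShift (-M) (L.toFun i x)) → L'.IsTrivial := by
  classical
  obtain ⟨e, he, hr, hd, R, hR⟩ := hT.exists_bounded_disks fun i x => hL i x
  obtain ⟨e', he', hr', hd', R', hR'⟩ := hT'.exists_bounded_disks fun i x => hL i x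
  have habs : ∀ (v : E3) {r : ℝ}, v ∈ Metric.ball (0 : E3) r → |v 2| < r := fun v r hv => by
    have := PiLp.norm_apply_le v 2
    rw [Real.norm_eq_abs] at this
    exact this.trans_lt (by simpa using hv)
  -- Disks inside the ball of radius `R` have heights of absolute value less than `R`, so a shift by
  -- at least `R` takes them off the plane `z = 0`.
  refine ⟨max R R', fun M hM L' h1 h2 => ?_⟩
  have hMR := (le_max_left _ _).trans hM
  have hMR' := (le_max_right _ _).trans hM
  let f : ι → E3 → S3 := fun i =>
    if hi : i ∈ T then verticalShift M ∘ e ⟨i, hi⟩ else verticalShift (-M) ∘ e' ⟨i, hi⟩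
  have hfT : ∀ i (hi : i ∈ T), f i = verticalShift M ∘ e ⟨i, hi⟩ := fun i hi => dif_pos hi
  have hfT' : ∀ i (hi : i ∉ T), f i = verticalShift (-M) ∘ e' ⟨i, hi⟩ := fun i hi => dif_neg hi
  have hup : ∀ i ∈ T, f i '' {v | v 2 = 0 ∧ ‖v‖ ≤ 1} ⊆ (↑) '' {v : E3 | 0 < v 2} := by
    intro i hi
    rw [hfT i hi, image_comp]
    rintro _ ⟨y, hy, rfl⟩
    obtain ⟨v, hv, rfl⟩ := hR _ hy
    refine ⟨_, ?_, (verticalShift_coe M v).symm⟩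
    have := abs_lt.1 (habs v hv)
    simp only [mem_ofPred_eq, PiLp.add_apply, PiLp.single_apply, if_true]
    linarith
  have hdown : ∀ i ∉ T, f i '' {v | v 2 = 0 ∧ ‖v‖ ≤ 1} ⊆ (↑) '' {v : E3 | v 2 < 0} := by
    intro i hi
    rw [hfT' i hi, image_comp]
    rintro _ ⟨y, hy, rfl⟩
    obtain ⟨v, hv, rfl⟩ := hR' _ hy
    refine ⟨_, ?_, (verticalShift_coe (-M) v).symm⟩
    have := abs_lt.1 (habs v hv)
    simp only [mem_ofPred_eq, PiLp.add_apply, PiLp.single_apply, if_true]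
    linarith
  have hsep : Disjoint ((↑) '' {v : E3 | 0 < v 2} : Set S3) ((↑) '' {v : E3 | v 2 < 0}) := by
    rw [disjoint_image_iff OnePoint.coe_injective, Set.disjoint_left]
    intro v hv hv'
    exact lt_asymm (α := ℝ) hv hv'
  refine ⟨f, fun i => ?_, fun i => ?_, fun i j hij => ?_⟩
  · by_cases hi : i ∈ T
    · rw [hfT i hi]
      exact (verticalShift M).isOpenEmbedding.comp (he _)
    · rw [hfT' i hi]
      exact (verticalShift (-M)).isOpenEmbedding.comp (he' _)
  · by_cases hi : i ∈ T
    · rw [hfT i hi, image_comp, hr, ← range_comp]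
      exact congrArg range (funext fun x => (h1 i hi x).symm)
    · rw [hfT' i hi, image_comp, hr', ← range_comp]
      exact congrArg range (funext fun x => (h2 i hi x).symm)
  · change Disjoint _ _
    by_cases hi : i ∈ T <;> by_cases hj : j ∈ T
    · rw [hfT i hi, hfT j hj, image_comp, image_comp, disjoint_image_iff (verticalShift M).injective]
      exact hd fun h => hij (congrArg Subtype.val h :)
    · exact hsep.mono (hup i hi) (hdown j hj)
    · exact (hsep.mono (hup j hj) (hdown i hi)).symm
    · rw [hfT' i hi, hfT' j hj, image_comp, image_comp,
        disjoint_image_iff (verticalShift (-M)).injective]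
      exact hd' fun h => hij (congrArg Subtype.val h :)

end Link

theorem verticalShift_spacePoint (M : ℝ) (p : EuclideanSpace ℝ (Fin 2)) (z : ℝ) :
    Link.verticalShift M (spacePoint p z : S3) = (spacePoint p (z + M) : S3) := by
  rw [Link.verticalShift_coe]
  congr 1
  ext k
  fin_cases k <;> simp [spacePoint]

namespace Diagram

variable {ι : Type}

theorem continuous_height (D : Diagram ι) (i : ι) : Continuous (D.height i) :=
  D.exists_height.choose_spec.1 i

theorem height_lt (D : Diagram ι) {c : (ι × UnitAddCircle) × (ι × UnitAddCircle)}
    (hc : c ∈ D.crossings) : D.height c.2.1 c.2.2 < D.height c.1.1 c.1.2 :=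
  D.exists_height.choose_spec.2 c hc

theorem link_apply (D : Diagram ι) (i : ι) (x : UnitAddCircle) :
    D.link.toFun i x = (spacePoint (D.curve i x) (D.height i x) : S3) := rfl

theorem exists_height_bound [Finite ι] (D : Diagram ι) : ∃ B : ℝ, ∀ i x, |D.height i x| < B := by
  have h : ∀ i, ∃ B : ℝ, ∀ x, |D.height i x| ≤ B := fun i => by
    obtain ⟨B, hB⟩ := (isCompact_range (D.continuous_height i).abs).bddAbove
    exact ⟨B, fun x => hB ⟨x, rfl⟩⟩
  choose B hB using h
  obtain ⟨C, hC⟩ := (finite_range B).bddAbove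
  exact ⟨C + 1, fun i x => ((hB i x).trans (hC ⟨i, rfl⟩)).trans_lt (lt_add_one C)⟩

/-- Over the sublink with components in `s`, two systems of heights which order the strands in the
same way at every crossing differ by a map which is affine on vertical lines. -/
theorem exists_vertical_affine [Finite ι] (D : Diagram ι) (s : Set ι)
    (h h' : ι → UnitAddCircle → ℝ) (hh : ∀ i, Continuous (h i)) (hh' : ∀ i, Continuous (h' i))
    (hord : ∀ c ∈ D.crossings, c.1.1 ∈ s → c.2.1 ∈ s →
      0 < (h c.1.1 c.1.2 - h c.2.1 c.2.2) * (h' c.1.1 c.1.2 - h' c.2.1 c.2.2)) :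
    ∃ lam phi : EuclideanSpace ℝ (Fin 2) → ℝ, Continuous lam ∧ Continuous phi ∧ (∀ p, 0 < lam p) ∧
      ∀ i ∈ s, ∀ x, h' i x = lam (D.curve i x) * h i x + phi (D.curve i x) := by
  have hinj : Function.Injective fun a : s × UnitAddCircle => ((a.1 : ι), a.2) :=
    fun a b hab => Prod.ext (Subtype.ext (congrArg Prod.fst hab :)) (congrArg Prod.snd hab :)
  have key := _root_.exists_vertical_affine (ι := s)
    (fun i => D.curve i) (fun i => h i) (fun i => h' i) (fun i => D.continuous_curve i)
    (fun i => hh i) (fun i => hh' i) ?_ ?_ ?_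
  · obtain ⟨lam, phi, h1, h2, h3, h4⟩ := key
    exact ⟨lam, phi, h1, h2, h3, fun i hi x => h4 ⟨i, hi⟩ x⟩
  · refine (((D.finite_crossings.image Prod.fst).union
      (D.finite_crossings.image Prod.snd)).preimage hinj.injOn).subset ?_
    rintro a ⟨b, hab, he⟩
    rcases (D.double_point (a.1, a.2) (b.1, b.2)).1 ⟨fun h => hab (hinj h), he⟩ with hc | hc
    · exact Or.inl ⟨_, hc, rfl⟩
    · exact Or.inr ⟨_, hc, rfl⟩
  · intro a b c hab hbc
    rcases D.no_triple_point (a.1, a.2) (b.1, b.2) (c.1, c.2) hab hbc with e | e | e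
    · exact Or.inl (hinj e)
    · exact Or.inr (Or.inl (hinj e))
    · exact Or.inr (Or.inr (hinj e))
  · intro a b hab he
    rcases (D.double_point (a.1, a.2) (b.1, b.2)).1 ⟨fun h => hab (hinj h), he⟩ with hc | hc
    · exact hord _ hc a.1.2 b.1.2
    · have := hord _ hc b.1.2 a.1.2
      simp only at this
      linarith

/-- If the heights on the components in `T` are raised and the others are lowered, and no component
in `T` passes below one not in `T`, then the link stays in its isotopy class. -/
theorem exists_isotopic_shift [Finite ι] (D : Diagram ι) {T : Set ι}
    (hT : ∀ c ∈ D.crossings, c.2.1 ∈ T → c.1.1 ∈ T) {M : ℝ} (hM : 0 ≤ M) :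
    ∃ L' : Link ι, D.link.Isotopic L' ∧
      (∀ i ∈ T, ∀ x, L'.toFun i x = Link.verticalShift M (D.link.toFun i x)) ∧
      (∀ i ∉ T, ∀ x, L'.toFun i x = Link.verticalShift (-M) (D.link.toFun i x)) := by
  classical
  let h' : ι → UnitAddCircle → ℝ := fun i x => D.height i x + if i ∈ T then M else -M
  have key := D.exists_vertical_affine univ D.height h'
    D.continuous_height (fun i => (D.continuous_height i).add continuous_const) ?_
  · obtain ⟨lam, phi, h1, h2, h3, h4⟩ := key
    refine ⟨_, D.link.isotopic_map_verticalHomeo lam phi h1 h2 h3, fun i hi x => ?_,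
      fun i hi x => ?_⟩
    all_goals
      rw [link_apply, verticalShift_spacePoint]
      refine congrArg OnePoint.some ((verticalHomeo_spacePoint lam phi h1 h2
        (fun p => (h3 p).ne') (D.curve i x) (D.height i x)).trans ?_)
      rw [← h4 i (mem_univ i) x]
      simp [h', hi]
  · intro c hc _ _
    have hlt := D.height_lt hc
    -- The upper strand never moves by less than the lower one, so the order at the crossing
    -- persists.
    have hle : (if c.2.1 ∈ T then M else -M) ≤ if c.1.1 ∈ T then M else -M := by
      by_cases hc2 : c.2.1 ∈ T
      · simp [hc2, hT c hc hc2]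
      · rw [if_neg hc2]
        split_ifs <;> linarith
    exact mul_pos (by linarith) (by simp only [h']; linarith)

/-- Used with `ε = 1` when the crossings within `s` are kept, and with `ε = -1` when all of them are
changed. In the latter case the vertical map has negative slope, that is, it reflects. -/
theorem isTrivial_sub_of_height [Finite ι] {D D' : Diagram ι} (hcurve : D'.curve = D.curve)
    {s : Set ι} (ε : ℝ) (hε : ε ≠ 0)
    (hord : ∀ c ∈ D'.crossings, c.1.1 ∈ s → c.2.1 ∈ s →
      0 < ε * (D.height c.1.1 c.1.2 - D.height c.2.1 c.2.2))
    (hD : (D.link.sub s).IsTrivial) : (D'.link.sub s).IsTrivial := by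
  obtain ⟨lam, phi, h1, h2, h3, h4⟩ := D'.exists_vertical_affine s (fun i x => ε * D.height i x)
    D'.height (fun i => continuous_const.mul (D.continuous_height i)) D'.continuous_height
    (fun c hc hc1 hc2 => by
      have := hord c hc hc1 hc2
      have h' := D'.height_lt hc
      exact mul_pos (by linarith) (by linarith))
  refine hD.of_homeomorph (verticalHomeo (fun p => lam p * ε) phi (by fun_prop) h2
    fun p => mul_ne_zero (h3 p).ne' hε).onePointCongr fun i => ?_
  rw [← range_comp]
  refine congrArg range (funext fun x => ?_)
  refine congrArg OnePoint.some ((verticalHomeo_spacePoint _ phi (by fun_prop) h2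
    (fun p => mul_ne_zero (h3 p).ne' hε) (D.curve i x) (D.height i x)).trans ?_)
  rw [mul_assoc, ← hcurve, ← h4 i i.2 x]
  rfl

variable (D : Diagram ι) (T : Set ι)

theorem mem_crossings_change_under {c : (ι × UnitAddCircle) × (ι × UnitAddCircle)} :
    c ∈ (D.change (⋃ i ∈ T, D.underCrossings i)).crossings ↔
      (c ∈ D.crossings ∧ c.2.1 ∉ T) ∨ (c.swap ∈ D.crossings ∧ c.1.1 ∈ T) := by
  simp only [change, underCrossings, mem_ofPred_eq, mem_iUnion, exists_prop, Prod.snd_swap]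
  constructor
  · rintro (⟨h, h'⟩ | ⟨h, i, hi, -, rfl⟩)
    · exact Or.inl ⟨h, fun ht => h' ⟨_, ht, h, rfl⟩⟩
    · exact Or.inr ⟨h, hi⟩
  · rintro (⟨h, h'⟩ | ⟨h, h'⟩)
    · refine Or.inl ⟨h, ?_⟩
      rintro ⟨i, hi, -, rfl⟩
      exact h' hi
    · exact Or.inr ⟨h, _, h', h, rfl⟩

/-- Changing the crossings in which the components in `T` pass below gives a split union of two
trivial links if the corresponding sublinks are trivial. -/
theorem change_under_isSplit_isTrivial [Finite ι] (hT : (D.link.sub T).IsTrivial)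
    (hT' : (D.link.sub Tᶜ).IsTrivial) {D' : Diagram ι}
    (hD' : D' = D.change (⋃ i ∈ T, D.underCrossings i)) :
    (∀ c ∈ D'.crossings, c.2.1 ∈ T → c.1.1 ∈ T) ∧ D'.link.IsSplit T ∧
      (D'.link.sub T).IsTrivial ∧ (D'.link.sub Tᶜ).IsTrivial ∧ D'.link.IsTrivial := by
  have hcr : ∀ c, c ∈ D'.crossings ↔
      (c ∈ D.crossings ∧ c.2.1 ∉ T) ∨ (c.swap ∈ D.crossings ∧ c.1.1 ∈ T) := fun c => by
    rw [hD', mem_crossings_change_under]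
  have hcurve : D'.curve = D.curve := by rw [hD']; rfl
  have hup : ∀ c ∈ D'.crossings, c.2.1 ∈ T → c.1.1 ∈ T := fun c hc h => by
    rcases (hcr c).1 hc with h' | h'
    · exact absurd h h'.2
    · exact h'.2
  have t1 : (D'.link.sub T).IsTrivial := by
    refine isTrivial_sub_of_height hcurve (-1) (by norm_num) (fun c hc h1 h2 => ?_) hT
    rcases (hcr c).1 hc with h' | h'
    · exact absurd h2 h'.2
    · have := D.height_lt h'.1
      simp only [Prod.snd_swap, Prod.fst_swap] at this
      linarith
  have t2 : (D'.link.sub Tᶜ).IsTrivial := by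
    refine isTrivial_sub_of_height hcurve 1 (by norm_num) (fun c hc h1 h2 => ?_) hT'
    rcases (hcr c).1 hc with h' | h'
    · have := D.height_lt h'.1
      linarith
    · exact absurd h'.2 h1
  obtain ⟨M, hM⟩ := Link.exists_isTrivial_of_shift t1 t2 fun i x => OnePoint.coe_ne_infty _
  obtain ⟨B, hB⟩ := D'.exists_height_bound
  -- The three bounds on the shift serve different ends: `0` for the isotopy, `M` for disjoint
  -- disks, `B` for putting the link itself into the two half spaces.
  obtain ⟨L', hL', hLT, hLT'⟩ := D'.exists_isotopic_shift hup (le_max_left 0 (max M B))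
  refine ⟨hup, ⟨L', hL', fun i hi x => ?_, fun i hi x => ?_⟩, t1, t2, ?_⟩
  · refine ⟨_, (hLT i hi x).trans (verticalShift_spacePoint _ _ _), ?_⟩
    have h1 := abs_lt.1 (hB i x)
    have h2 := (le_max_right M B).trans (le_max_right 0 (max M B))
    rw [spacePoint_two]
    linarith
  · refine ⟨_, (hLT' i hi x).trans (verticalShift_spacePoint _ _ _), ?_⟩
    have h1 := abs_lt.1 (hB i x)
    have h2 := (le_max_right M B).trans (le_max_right 0 (max M B))
    rw [spacePoint_two]
    linarith
  · obtain ⟨g, hg⟩ := hL'.symm.exists_homeomorph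
    exact (hM _ ((le_max_left M B).trans (le_max_right 0 (max M B))) L' hLT hLT').of_homeomorph g hg

end Diagram

theorem Link.IsBrunnian.isTrivial_sub {ι : Type} {L L' : Link ι} (hB : L.IsBrunnian)
    (h : L.Isotopic L') {s : Set ι} (hs : s ≠ univ) : (L'.sub s).IsTrivial := by
  obtain ⟨i, hi⟩ := (ne_univ_iff_exists_notMem s).1 hs
  obtain ⟨g, hg⟩ := h.exists_homeomorph
  refine ((hB i).sub_of_subset (s := s) fun j hj => ?_).of_homeomorph g fun j => hg j
  rintro rfl
  exact hi hj

/-! ### Lipschitz estimates and isotopies -/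

/-- Compactness of `X × X`: near the diagonal the local bound applies, and near any other point
`dist (c a) (c b)` is bounded below while `φ` is bounded. -/
theorem exists_dist_bound_of_locally {X E : Type*} [TopologicalSpace X] [CompactSpace X]
    [MetricSpace E] {c : X → E} {φ : X → ℝ} (hc : Continuous c) (hinj : Function.Injective c)
    (hφ : Continuous φ)
    (hloc : ∀ p, ∃ U ∈ 𝓝 p, ∃ C : ℝ, ∀ a ∈ U, ∀ b ∈ U, |φ a - φ b| ≤ C * dist (c a) (c b)) :
    ∃ C : ℝ, 0 ≤ C ∧ ∀ a b, |φ a - φ b| ≤ C * dist (c a) (c b) := by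
  have key : ∃ C : ℝ, 0 ≤ C ∧ ∀ p ∈ (univ : Set (X × X)),
      |φ p.1 - φ p.2| ≤ C * dist (c p.1) (c p.2) := by
    refine isCompact_univ.induction_on (p := fun s : Set (X × X) => ∃ C : ℝ, 0 ≤ C ∧ ∀ p ∈ s,
      |φ p.1 - φ p.2| ≤ C * dist (c p.1) (c p.2)) ⟨0, le_rfl, by simp⟩ ?_ ?_ ?_
    · rintro s t hst ⟨C, hC, h⟩
      exact ⟨C, hC, fun p hp => h p (hst hp)⟩
    · rintro s t ⟨C, hC, h⟩ ⟨C', hC', h'⟩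
      refine ⟨C + C', by positivity, ?_⟩
      have hd : ∀ p : X × X, 0 ≤ dist (c p.1) (c p.2) := fun p => dist_nonneg
      rintro p (hp | hp)
      · have := h p hp
        have := mul_nonneg hC' (hd p)
        linarith
      · have := h' p hp
        have := mul_nonneg hC (hd p)
        linarith
    · rintro ⟨p, q⟩ -
      by_cases hpq : p = q
      · subst hpq
        obtain ⟨U, hU, C, hC⟩ := hloc p
        refine ⟨U ×ˢ U, mem_nhdsWithin_of_mem_nhds (prod_mem_nhds hU hU), max C 0,
          le_max_right _ _, fun r hr => (hC _ hr.1 _ hr.2).trans ?_⟩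
        gcongr
        exact le_max_left _ _
      · have hη : 0 < dist (c p) (c q) := dist_pos.2 (hinj.ne hpq)
        have hd : Continuous fun r : X × X => dist (c r.1) (c r.2) := by fun_prop
        have hf : Continuous fun r : X × X => |φ r.1 - φ r.2| := by fun_prop
        have h1 : ∀ᶠ r : X × X in 𝓝 (p, q), dist (c p) (c q) / 2 < dist (c r.1) (c r.2) :=
          hd.continuousAt.eventually_const_lt (half_lt_self hη)
        have h2 : ∀ᶠ r : X × X in 𝓝 (p, q), |φ r.1 - φ r.2| < |φ p - φ q| + 1 :=
          hf.continuousAt.eventually_lt_const (lt_add_one _)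
        refine ⟨_, mem_nhdsWithin_of_mem_nhds (h1.and h2),
          (|φ p - φ q| + 1) / (dist (c p) (c q) / 2), by positivity, fun r hr => ?_⟩
        refine hr.2.le.trans ?_
        rw [div_mul_eq_mul_div, le_div_iff₀ (by positivity)]
        have := hr.1.le
        gcongr
  obtain ⟨C, hC, h⟩ := key
  exact ⟨C, hC, fun a b => h (a, b) (mem_univ _)⟩

open NNReal in
theorem exists_lipschitz_extension {X E : Type*} [MetricSpace E] {c : X → E} {φ : X → ℝ}
    (hinj : Function.Injective c) {C : ℝ} (hC : 0 ≤ C)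
    (h : ∀ a b, |φ a - φ b| ≤ C * dist (c a) (c b)) :
    ∃ ψ : E → ℝ, LipschitzWith ⟨C, hC⟩ ψ ∧ ∀ a, ψ (c a) = φ a := by
  have hl : LipschitzOnWith ⟨C, hC⟩ (Function.extend c φ 0) (range c) := by
    refine LipschitzOnWith.of_dist_le_mul ?_
    rintro _ ⟨a, rfl⟩ _ ⟨b, rfl⟩
    rw [hinj.extend_apply, hinj.extend_apply]
    exact h a b
  obtain ⟨ψ, hψ, he⟩ := hl.extend_real
  exact ⟨ψ, hψ, fun a => by rw [← he ⟨a, rfl⟩, hinj.extend_apply]⟩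

/-- A displacement field with Lipschitz constant less than one is realized by an isotopy. -/
theorem exists_isotopy_of_lipschitz {δ : E3 → E3} {K : NNReal} (hK : K < 1)
    (h : LipschitzWith K δ) :
    ∃ H : unitInterval → E3 ≃ₜ E3, (Continuous fun p : unitInterval × E3 => H p.1 p.2) ∧
      (Continuous fun p : unitInterval × E3 => (H p.1).symm p.2) ∧
      ∀ t x, H t x = x + (t : ℝ) • δ x := by
  have hl : ∀ t : unitInterval, LipschitzWith K fun x => (t : ℝ) • δ x := fun t =>
    LipschitzWith.of_dist_le_mul fun x y => by
      rw [dist_smul₀, Real.norm_eq_abs, abs_of_nonneg t.2.1]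
      exact (mul_le_of_le_one_left dist_nonneg t.2.2).trans (h.dist_le_mul x y)
  choose H hH using fun t => exists_homeomorph_add_lipschitz hK (hl t)
  have hK' : (K : ℝ) < 1 := by exact_mod_cast hK
  have hδ := h.continuous
  have hcont : Continuous fun p : unitInterval × E3 => H p.1 p.2 := by
    simp only [hH]
    fun_prop
  refine ⟨H, hcont, ?_, hH⟩
  -- The inverses are Lipschitz with a constant independent of `t`, which yields their joint
  -- continuity.
  have hanti : ∀ t x y, dist x y ≤ (1 - (K : ℝ))⁻¹ * dist (H t x) (H t y) := by
    intro t x y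
    rw [inv_mul_eq_div, le_div_iff₀ (by linarith)]
    have h1 := (hl t).dist_le_mul x y
    have h2 : dist x y ≤ dist (H t x) (H t y) + dist ((t : ℝ) • δ x) ((t : ℝ) • δ y) := by
      rw [hH, hH, dist_eq_norm, dist_eq_norm, dist_eq_norm]
      refine le_trans (le_of_eq ?_) (norm_sub_le _ _)
      congr 1
      abel
    nlinarith
  rw [continuous_iff_continuousAt]
  rintro ⟨s, y⟩
  rw [ContinuousAt, tendsto_iff_dist_tendsto_zero]
  have hg : Continuous fun p : unitInterval × E3 =>
      (1 - (K : ℝ))⁻¹ * dist p.2 (H p.1 ((H s).symm y)) :=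
    continuous_const.mul (continuous_snd.dist (hcont.comp (continuous_fst.prodMk continuous_const)))
  have hg0 := hg.tendsto (s, y)
  simp only [Homeomorph.apply_symm_apply, dist_self, mul_zero] at hg0
  refine squeeze_zero (fun _ => dist_nonneg) (fun p => ?_) hg0
  have := hanti p.1 ((H p.1).symm p.2) ((H s).symm y)
  rwa [Homeomorph.apply_symm_apply] at this

/-- Two rays that are disjoint away from their common end diverge linearly. -/
theorem exists_le_norm_smul_sub_smul {E : Type*} [NormedAddCommGroup E] [NormedSpace ℝ E]
    {u w : E} {ε : ℝ} (hε : 0 < ε)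
    (hne : ∀ h k : ℝ, 0 ≤ h → 0 ≤ k → h ≤ ε → k ≤ ε → 0 < h + k → h • w ≠ k • u) :
    ∃ κ : ℝ, 0 < κ ∧ ∀ h k : ℝ, 0 ≤ h → 0 ≤ k → κ * (h + k) ≤ ‖h • w - k • u‖ := by
  have hf : Continuous fun θ : ℝ => ‖θ • w - (1 - θ) • u‖ := by fun_prop
  -- By homogeneity it suffices to treat `h + k = 1`. The constant is the distance from the origin
  -- to the segment from `-u` to `w`, which misses the origin since the rays do not meet.
  obtain ⟨θ, hθ, hmin⟩ := isCompact_Icc.exists_isMinOn (nonempty_Icc.2 zero_le_one)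
    (hf.continuousOn (s := Icc (0 : ℝ) 1))
  refine ⟨‖θ • w - (1 - θ) • u‖, ?_, fun h k hh hk => ?_⟩
  · rw [norm_pos_iff, sub_ne_zero]
    intro he
    refine hne (ε * θ) (ε * (1 - θ)) (mul_nonneg hε.le hθ.1)
      (mul_nonneg hε.le (sub_nonneg.2 hθ.2)) ?_ ?_ ?_ ?_
    · nlinarith [hθ.2]
    · nlinarith [hθ.1]
    · linarith
    · rw [mul_smul, mul_smul, he]
  · rcases (add_nonneg hh hk).eq_or_lt with h0 | h0
    · rw [← h0, mul_zero]
      exact norm_nonneg _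
    · have hm : h / (h + k) ∈ Icc (0 : ℝ) 1 :=
        ⟨by positivity, (div_le_one h0).2 (by linarith)⟩
      have h1 := isMinOn_iff.1 hmin _ hm
      have h2 : h • w - k • u = (h + k) • ((h / (h + k)) • w - (1 - h / (h + k)) • u) := by
        rw [smul_sub, smul_smul, smul_smul]
        congr 2 <;> field_simp
        ring
      rw [h2, norm_smul, Real.norm_eq_abs, abs_of_pos h0, mul_comm]
      gcongr

/-! ### Closed polygons parametrized by the circle -/

namespace UnitAddCircle

theorem coe_eq_coe_of_sub_eq_int {x y : ℝ} (n : ℤ) (h : x - y = n) :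
    (x : UnitAddCircle) = (y : UnitAddCircle) := by
  rw [← sub_eq_zero, ← AddCircle.coe_sub, AddCircle.coe_eq_zero_iff]
  exact ⟨n, by simp [h]⟩

theorem coe_ne_coe_of_lt {x y : ℝ} (h : x < y) (h' : y < x + 1) :
    (x : UnitAddCircle) ≠ (y : UnitAddCircle) := by
  rw [ne_comm, ← sub_ne_zero, ← AddCircle.coe_sub, Ne, AddCircle.coe_eq_zero_iff]
  rintro ⟨n, hn⟩
  rw [zsmul_eq_mul, mul_one] at hn
  have h1 : (0 : ℝ) < n := by linarith
  have h2 : (n : ℝ) < 1 := by linarith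
  have h1' : 0 < n := by exact_mod_cast h1
  have h2' : n < 1 := by exact_mod_cast h2
  omega

theorem norm_coe_le (x : ℝ) : ‖(x : UnitAddCircle)‖ ≤ |x| := by
  rw [UnitAddCircle.norm_eq]
  simpa using round_le x 0

theorem norm_coe_eq_min {x : ℝ} (h0 : 0 ≤ x) (h1 : x ≤ 1) :
    ‖(x : UnitAddCircle)‖ = min x (1 - x) := by
  rw [UnitAddCircle.norm_eq, abs_sub_round_eq_min]
  rcases h1.eq_or_lt with rfl | h1
  · simp
  · rw [Int.fract_eq_self.2 ⟨h0, h1⟩]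

theorem coe_mod_add_div {m : ℕ} (hm : 0 < m) (k : ℕ) (s : ℝ) :
    (((((k % m : ℕ) : ℝ) + s) / m : ℝ) : UnitAddCircle) = ((((k : ℝ) + s) / m : ℝ) : UnitAddCircle) := by
  refine coe_eq_coe_of_sub_eq_int (-((k / m : ℕ) : ℤ)) ?_
  have hm' : (m : ℝ) ≠ 0 := by positivity
  have h : ((k % m : ℕ) : ℝ) + m * ((k / m : ℕ) : ℝ) = k := by exact_mod_cast Nat.mod_add_div k m
  rw [Int.cast_neg, Int.cast_natCast]
  field_simp
  linarith

theorem exists_nat_add_div {m : ℕ} (hm : 0 < m) (x : UnitAddCircle) :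
    ∃ k < m, ∃ s ∈ Ico (0 : ℝ) 1, x = ((((k : ℕ) : ℝ) + s) / m : ℝ) := by
  induction x using QuotientAddGroup.induction_on with
  | H y =>
    have hm' : (0 : ℝ) < m := by positivity
    have h0 : 0 ≤ m * Int.fract y := mul_nonneg hm'.le (Int.fract_nonneg y)
    refine ⟨⌊m * Int.fract y⌋₊, ?_, m * Int.fract y - ⌊m * Int.fract y⌋₊,
      ⟨sub_nonneg.2 (Nat.floor_le h0), ?_⟩, ?_⟩
    · rw [Nat.floor_lt h0]
      exact mul_lt_of_lt_one_right hm' (Int.fract_lt_one y)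
    · have := Nat.lt_floor_add_one (m * Int.fract y)
      linarith
    · rw [add_sub_cancel, mul_div_cancel_left₀ _ hm'.ne']
      exact coe_eq_coe_of_sub_eq_int ⌊y⌋ (by simp)

end UnitAddCircle

namespace IsPolygon

variable {E F : Type}

section Module

variable [AddCommGroup E] [Module ℝ E] {c : UnitAddCircle → E} {m : ℕ}

theorem apply_eq (h : IsPolygon c m) (j : ℕ) {y : ℝ} (h0 : (j : ℝ) ≤ m * y) (h1 : m * y ≤ j + 1) :
    c (y : UnitAddCircle) = c (((j : ℝ) / m : ℝ) : UnitAddCircle) + (m * y - j) •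
      (c ((((j : ℝ) + 1) / m : ℝ) : UnitAddCircle) - c (((j : ℝ) / m : ℝ) : UnitAddCircle)) := by
  have hm : (m : ℝ) ≠ 0 := by exact_mod_cast h.1.ne'
  have := h.2 j (m * y - j) ⟨by linarith, by linarith⟩
  rw [add_sub_cancel, mul_div_cancel_left₀ _ hm] at this
  rw [this, AffineMap.lineMap_apply_module', add_comm]

/-- A simple closed polygon has at least three edges. -/
theorem three_le (h : IsPolygon c m) (hinj : Function.Injective c) : 3 ≤ m := by
  have hm := h.1
  by_contra hlt
  obtain rfl | rfl : m = 1 ∨ m = 2 := by omega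
  · have h1 := h.2 0 (1 / 2) (by norm_num)
    have e : (((((0 : ℕ) : ℝ) + 1) / (1 : ℕ) : ℝ) : UnitAddCircle) =
        ((((0 : ℕ) : ℝ) / (1 : ℕ) : ℝ) : UnitAddCircle) :=
      UnitAddCircle.coe_eq_coe_of_sub_eq_int 1 (by norm_num)
    rw [e, AffineMap.lineMap_same_apply] at h1
    exact UnitAddCircle.coe_ne_coe_of_lt (by norm_num) (by norm_num) (hinj h1).symm
  -- With two edges the same segment is traversed back and forth, so the midpoints of the edges
  -- coincide.
  · have h1 := h.2 0 (1 / 2) (by norm_num)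
    have h2 := h.2 1 (1 / 2) (by norm_num)
    have e : (((((1 : ℕ) : ℝ) + 1) / (2 : ℕ) : ℝ) : UnitAddCircle) =
        ((((0 : ℕ) : ℝ) / (2 : ℕ) : ℝ) : UnitAddCircle) :=
      UnitAddCircle.coe_eq_coe_of_sub_eq_int 1 (by norm_num)
    have e' : (((((0 : ℕ) : ℝ) + 1) / (2 : ℕ) : ℝ) : UnitAddCircle) =
        ((((1 : ℕ) : ℝ) / (2 : ℕ) : ℝ) : UnitAddCircle) := by norm_num
    rw [e, AffineMap.lineMap_symm] at h2
    rw [e'] at h1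
    have h3 : c ((((0 : ℕ) : ℝ) + 1 / 2) / (2 : ℕ) : ℝ) = c ((((1 : ℕ) : ℝ) + 1 / 2) / (2 : ℕ) : ℝ) := by
      rw [h1, h2]
      simp only [AffineMap.coe_comp, Function.comp_apply, AffineMap.lineMap_apply_module]
      norm_num
    exact UnitAddCircle.coe_ne_coe_of_lt (by norm_num) (by norm_num) (hinj h3)

theorem add {c' : UnitAddCircle → E} (h : IsPolygon c m) (h' : IsPolygon c' m) :
    IsPolygon (fun x => c x + c' x) m :=
  ⟨h.1, fun j s hs => by
    simp only [h.2 j s hs, h'.2 j s hs, AffineMap.lineMap_apply_module]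
    module⟩

theorem sum {κ : Type*} (t : Finset κ) {f : κ → UnitAddCircle → E} (hm : 0 < m)
    (h : ∀ k, IsPolygon (f k) m) : IsPolygon (fun x => ∑ k ∈ t, f k x) m := by
  classical
  induction t using Finset.induction_on with
  | empty => exact ⟨hm, fun j s hs => by simp⟩
  | insert a t ha ih =>
    simp only [Finset.sum_insert ha]
    exact (h a).add ih

theorem map [AddCommGroup F] [Module ℝ F] (h : IsPolygon c m) (f : E →ₗ[ℝ] F) :
    IsPolygon (fun x => f (c x)) m :=
  ⟨h.1, fun j s hs => by simp [h.2 j s hs, AffineMap.lineMap_apply_module]⟩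

end Module

variable [NormedAddCommGroup E] [NormedSpace ℝ E] {c : UnitAddCircle → E} {m : ℕ}

/-- In the proof, `j` indexes the edge ahead of `x` and `k` the edge behind; they differ exactly at
vertices. The bound `1 ≤ x`, harmless by periodicity, ensures that an edge with natural index lies
behind. -/
theorem exists_one_sided_affine (h : IsPolygon c m) {x : ℝ} (hx : 1 ≤ x) :
    ∃ ε : ℝ, 0 < ε ∧ ∃ u w : E, ∀ t, 0 ≤ t → t ≤ ε →
      c ((x + t : ℝ) : UnitAddCircle) = c (x : UnitAddCircle) + t • w ∧
      c ((x - t : ℝ) : UnitAddCircle) = c (x : UnitAddCircle) + t • u := by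
  have hm : (0 : ℝ) < m := by exact_mod_cast h.1
  have hpos : 0 < m * x := by positivity
  have hf := Nat.floor_le hpos.le
  have hf' := Nat.lt_floor_add_one (m * x)
  obtain ⟨k, hk⟩ : ∃ k, ⌈m * x⌉₊ = k + 1 := Nat.exists_eq_succ_of_ne_zero (Nat.ceil_pos.2 hpos).ne'
  have hc : m * x ≤ k + 1 := by
    have := Nat.le_ceil (m * x)
    rw [hk] at this
    exact_mod_cast this
  have hc' : (k : ℝ) < m * x := Nat.lt_ceil.1 (by omega)
  set j := ⌊m * x⌋₊ with hj
  refine ⟨min ((j + 1 - m * x) / m) ((m * x - k) / m), lt_min (div_pos (by linarith) hm)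
    (div_pos (by linarith) hm), (-(m : ℝ)) • (c ((((k : ℝ) + 1) / m : ℝ) : UnitAddCircle) -
      c (((k : ℝ) / m : ℝ) : UnitAddCircle)), (m : ℝ) • (c ((((j : ℝ) + 1) / m : ℝ) : UnitAddCircle) -
      c (((j : ℝ) / m : ℝ) : UnitAddCircle)), fun t ht ht' => ?_⟩
  have h1 := ht'.trans (min_le_left _ _)
  have h2 := ht'.trans (min_le_right _ _)
  rw [le_div_iff₀ hm] at h1 h2
  have hmt : 0 ≤ m * t := by positivity
  constructor
  · rw [h.apply_eq j (y := x + t) (by linarith) (by linarith), h.apply_eq j (y := x) hf hf'.le]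
    module
  · rw [h.apply_eq k (y := x - t) (by linarith) (by linarith), h.apply_eq k (y := x) hc'.le hc]
    module

/-- A simple closed polygon is locally bi-Lipschitz. -/
theorem exists_local_antilipschitz (h : IsPolygon c m) (hinj : Function.Injective c)
    (x : UnitAddCircle) :
    ∃ U ∈ 𝓝 x, ∃ κ : ℝ, 0 < κ ∧ ∀ a ∈ U, ∀ b ∈ U, κ * ‖a - b‖ ≤ ‖c a - c b‖ := by
  obtain ⟨y, hy, rfl⟩ : ∃ y : ℝ, 1 ≤ y ∧ (y : UnitAddCircle) = x := by
    induction x using QuotientAddGroup.induction_on with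
    | H z =>
      refine ⟨Int.fract z + 1, by linarith [Int.fract_nonneg z], ?_⟩
      exact UnitAddCircle.coe_eq_coe_of_sub_eq_int (1 - ⌊z⌋)
        (by push_cast; linarith [Int.fract_add_floor z])
  obtain ⟨ε, hε, u, w, hloc⟩ := h.exists_one_sided_affine hy
  -- The bound `1 / 3` keeps `y - s` and `y + t` less than a full turn apart, so injectivity
  -- prevents the two rays from meeting.
  have hmin : 0 < min ε (1 / 3) := lt_min hε (by norm_num)
  obtain ⟨κ, hκ, hdiv⟩ := exists_le_norm_smul_sub_smul (u := u) (w := w) hmin (by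
    intro t s ht hs ht' hs' hts he
    have h1 := (hloc t ht (ht'.trans (min_le_left _ _))).1
    have h2 := (hloc s hs (hs'.trans (min_le_left _ _))).2
    rw [he, ← h2] at h1
    have := ht'.trans (min_le_right _ _)
    have := hs'.trans (min_le_right _ _)
    exact UnitAddCircle.coe_ne_coe_of_lt (by linarith) (by linarith) (hinj h1).symm)
  have hw : κ ≤ ‖w‖ := by simpa using hdiv 1 0 zero_le_one le_rfl
  have hu : κ ≤ ‖u‖ := by simpa using hdiv 0 1 le_rfl zero_le_one
  have key : ∀ a b : ℝ, |a| ≤ ε → |b| ≤ ε → κ * |a - b| ≤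
      ‖c ((y + a : ℝ) : UnitAddCircle) - c ((y + b : ℝ) : UnitAddCircle)‖ := by
    have hneg : ∀ a : ℝ, |a| ≤ ε → a ≤ 0 →
        c ((y + a : ℝ) : UnitAddCircle) = c (y : UnitAddCircle) + (-a) • u := fun a ha ha0 => by
      have := (hloc (-a) (by linarith) (by rwa [abs_of_nonpos ha0] at ha)).2
      rwa [sub_neg_eq_add] at this
    have hpos : ∀ a : ℝ, |a| ≤ ε → 0 ≤ a →
        c ((y + a : ℝ) : UnitAddCircle) = c (y : UnitAddCircle) + a • w := fun a ha ha0 =>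
      (hloc a ha0 (by rwa [abs_of_nonneg ha0] at ha)).1
    intro a b ha hb
    rcases le_total 0 a with ha0 | ha0 <;> rcases le_total 0 b with hb0 | hb0
    · rw [hpos a ha ha0, hpos b hb hb0, add_sub_add_left_eq_sub, ← sub_smul, norm_smul,
        Real.norm_eq_abs, mul_comm]
      gcongr
    · rw [hpos a ha ha0, hneg b hb hb0, add_sub_add_left_eq_sub, abs_of_nonneg (by linarith)]
      exact hdiv a (-b) ha0 (by linarith)
    · rw [hneg a ha ha0, hpos b hb hb0, add_sub_add_left_eq_sub, abs_sub_comm, norm_sub_rev,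
        abs_of_nonneg (by linarith)]
      exact hdiv b (-a) hb0 (by linarith)
    · rw [hneg a ha ha0, hneg b hb hb0, add_sub_add_left_eq_sub, ← sub_smul, norm_smul,
        Real.norm_eq_abs, mul_comm, neg_sub_neg, abs_sub_comm]
      gcongr
  refine ⟨(fun z : ℝ => (z : UnitAddCircle)) '' Metric.ball y ε,
    (QuotientAddGroup.isOpenMap_coe _ Metric.isOpen_ball).mem_nhds
      ⟨y, Metric.mem_ball_self hε, rfl⟩, κ, hκ, ?_⟩
  rintro _ ⟨a, ha, rfl⟩ _ ⟨b, hb, rfl⟩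
  rw [Metric.mem_ball, Real.dist_eq] at ha hb
  have h1 := key (a - y) (b - y) ha.le hb.le
  rw [add_sub_cancel, add_sub_cancel, sub_sub_sub_cancel_right] at h1
  refine le_trans ?_ h1
  rw [← AddCircle.coe_sub]
  gcongr
  exact UnitAddCircle.norm_coe_le _

end IsPolygon

/-- The piecewise linear function on the circle with value one at `j / m`, and zero at the other
multiples of `1 / m`. -/
noncomputable def circleHat (m j : ℕ) (x : UnitAddCircle) : ℝ :=
  max (1 - m * ‖x - (((j : ℝ) / m : ℝ) : UnitAddCircle)‖) 0

theorem continuous_circleHat (m j : ℕ) : Continuous (circleHat m j) := by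
  unfold circleHat
  fun_prop

theorem abs_circleHat_sub_le (m j : ℕ) (x y : UnitAddCircle) :
    |circleHat m j x - circleHat m j y| ≤ m * ‖x - y‖ := by
  set v : UnitAddCircle := (((j : ℝ) / m : ℝ) : UnitAddCircle) with hv
  refine (abs_max_sub_max_le_abs _ _ _).trans ?_
  rw [← hv, show 1 - m * ‖x - v‖ - (1 - m * ‖y - v‖) = m * (‖y - v‖ - ‖x - v‖) by ring, abs_mul,
    Nat.abs_cast]
  gcongr
  refine (abs_norm_sub_norm_le _ _).trans_eq ?_
  rw [sub_sub_sub_cancel_right, norm_sub_rev]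

theorem circleHat_apply {m j k : ℕ} (hm : 2 ≤ m) (hj : j < m) (hk : k < m) {s : ℝ}
    (hs : s ∈ Icc (0 : ℝ) 1) :
    circleHat m j ((((k : ℝ) + s) / m : ℝ) : UnitAddCircle) =
      if k = j then 1 - s else if (k + 1) % m = j then s else 0 := by
  have hm0 : (0 : ℝ) < m := by positivity
  -- `r` is the residue of `k - j` modulo `m`, with `n` recording the wrap. The hat is nonzero only
  -- on the edges `r = 0` and `r = m - 1` next to the vertex `j`.
  obtain ⟨r, hr, n, hrn⟩ : ∃ r : ℕ, r < m ∧ ∃ n : ℕ, k + m * n = r + j ∧ n ≤ 1 := by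
    rcases le_or_gt j k with h | h
    · exact ⟨k - j, by omega, 0, by omega, by omega⟩
    · exact ⟨k + m - j, by omega, 1, by omega, le_rfl⟩
  obtain ⟨hrn, hn⟩ := hrn
  have hcast : (k : ℝ) + m * n = r + j := by exact_mod_cast hrn
  have hrm : (r : ℝ) + 1 ≤ m := by exact_mod_cast hr
  have e1 : ((((k : ℝ) + s) / m : ℝ) : UnitAddCircle) - (((j : ℝ) / m : ℝ) : UnitAddCircle) =
      ((((r : ℝ) + s) / m : ℝ) : UnitAddCircle) := by
    rw [← AddCircle.coe_sub]
    refine UnitAddCircle.coe_eq_coe_of_sub_eq_int (-n) ?_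
    push_cast
    field_simp
    linarith
  have e2 : circleHat m j ((((k : ℝ) + s) / m : ℝ) : UnitAddCircle) =
      max (1 - min ((r : ℝ) + s) (m - (r + s))) 0 := by
    rw [circleHat, e1, UnitAddCircle.norm_coe_eq_min (by have := hs.1; positivity)
      ((div_le_one hm0).2 (by linarith [hs.2])), mul_min_of_nonneg _ _ hm0.le]
    congr 3
    · field_simp
    · field_simp
  have hm2 : (2 : ℝ) ≤ m := by exact_mod_cast hm
  have hs0 := hs.1
  have hs1 := hs.2
  rw [e2]
  by_cases hkj : k = j
  · have hr0 : r = 0 := by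
      interval_cases n <;> omega
    rw [if_pos hkj, hr0, Nat.cast_zero, zero_add, min_eq_left (by linarith),
      max_eq_left (by linarith)]
  · rw [if_neg hkj]
    have hr0 : r ≠ 0 := by
      rintro rfl
      interval_cases n <;> omega
    by_cases hkj' : (k + 1) % m = j
    · have hr1 : r + 1 = m := by
        rcases (by omega : k + 1 < m ∨ k + 1 = m) with h | h
        · rw [Nat.mod_eq_of_lt h] at hkj'
          interval_cases n <;> omega
        · rw [h, Nat.mod_self] at hkj'
          interval_cases n <;> omega
      have hr1' : (r : ℝ) + 1 = m := by exact_mod_cast hr1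
      rw [if_pos hkj', ← hr1', min_eq_right (by linarith), max_eq_left (by linarith)]
      ring
    · rw [if_neg hkj']
      have hr2 : r + 2 ≤ m := by
        by_contra hlt
        have hr1 : r + 1 = m := by omega
        apply hkj'
        rcases (by omega : k + 1 < m ∨ k + 1 = m) with h | h
        · rw [Nat.mod_eq_of_lt h]
          interval_cases n <;> omega
        · rw [h, Nat.mod_self]
          interval_cases n <;> omega
      have hr2' : (r : ℝ) + 2 ≤ m := by exact_mod_cast hr2
      have hr0' : (1 : ℝ) ≤ r := by exact_mod_cast Nat.one_le_iff_ne_zero.2 hr0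
      refine max_eq_right ?_
      rw [sub_nonpos, le_min_iff]
      constructor <;> linarith

theorem circleHat_vertex {m j k : ℕ} (hm : 2 ≤ m) (hj : j < m) (hk : k < m) :
    circleHat m j (((k : ℝ) / m : ℝ) : UnitAddCircle) = if k = j then 1 else 0 := by
  have := circleHat_apply hm hj hk (s := 0) (by simp)
  rw [add_zero] at this
  rw [this]
  simp

theorem isPolygon_circleHat {m j : ℕ} (hm : 2 ≤ m) (hj : j < m) :
    IsPolygon (circleHat m j) m := by
  have hm0 : 0 < m := by omega
  refine ⟨hm0, fun k s hs => ?_⟩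
  have h : ∀ s ∈ Icc (0 : ℝ) 1, circleHat m j ((((k : ℝ) + s) / m : ℝ) : UnitAddCircle) =
      if k % m = j then 1 - s else if (k % m + 1) % m = j then s else 0 := fun s hs => by
    rw [← UnitAddCircle.coe_mod_add_div hm0, circleHat_apply hm hj (Nat.mod_lt _ hm0) hs]
  have h0 := h 0 (by simp)
  rw [add_zero] at h0
  rw [h s hs, h0, h 1 (by simp), AffineMap.lineMap_apply_module]
  split_ifs <;> simp

/-! ### Generic position in the plane -/

/-- Twice the signed area of a triangle in the plane. -/
def planeOrient (p q r : EuclideanSpace ℝ (Fin 2)) : ℝ :=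
  (q 0 - p 0) * (r 1 - p 1) - (q 1 - p 1) * (r 0 - p 0)

/-- The equation of the line through two points of the plane, evaluated at a third one, has the
coefficients `r 1 - p 1`, `p 0 - r 0` and `lineConst p r`. -/
def lineConst (p r : EuclideanSpace ℝ (Fin 2)) : ℝ :=
  -((r 1 - p 1) * p 0 + (p 0 - r 0) * p 1)

/-- The determinant of the equations of three lines in the plane, which vanishes if the lines are
concurrent. -/
def lineDet (p p' q q' r r' : EuclideanSpace ℝ (Fin 2)) : ℝ :=
  (p' 1 - p 1) * ((q 0 - q' 0) * lineConst r r' - (r 0 - r' 0) * lineConst q q')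
    - (p 0 - p' 0) * ((q' 1 - q 1) * lineConst r r' - (r' 1 - r 1) * lineConst q q')
    + lineConst p p' * ((q' 1 - q 1) * (r 0 - r' 0) - (r' 1 - r 1) * (q 0 - q' 0))

/-- The point dividing a segment in the plane with ratio `s`. -/
noncomputable def segPoint (p q : EuclideanSpace ℝ (Fin 2)) (s : ℝ) : EuclideanSpace ℝ (Fin 2) :=
  AffineMap.lineMap p q s

theorem segPoint_apply (p q : EuclideanSpace ℝ (Fin 2)) (s : ℝ) (k : Fin 2) :
    segPoint p q s k = (1 - s) * p k + s * q k := by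
  simp [segPoint, AffineMap.lineMap_apply_module]

theorem planeOrient_mul_eq_zero {p q r : EuclideanSpace ℝ (Fin 2)} {s t : ℝ}
    (h : segPoint p q s = segPoint q r t) : (1 - s) * planeOrient p q r = 0 := by
  have h0 := congrArg (fun v : EuclideanSpace ℝ (Fin 2) => v 0) h
  have h1 := congrArg (fun v : EuclideanSpace ℝ (Fin 2) => v 1) h
  simp only [segPoint_apply] at h0 h1
  rw [planeOrient]
  linear_combination -(r 1 - q 1) * h0 + (r 0 - q 0) * h1

theorem lineDet_eq_zero {p p' q q' r r' : EuclideanSpace ℝ (Fin 2)} {s t u : ℝ}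
    (h : segPoint p p' s = segPoint q q' t) (h' : segPoint q q' t = segPoint r r' u) :
    lineDet p p' q q' r r' = 0 := by
  have key : ∀ (p p' : EuclideanSpace ℝ (Fin 2)) (s : ℝ), (p' 1 - p 1) * segPoint p p' s 0 +
      (p 0 - p' 0) * segPoint p p' s 1 + lineConst p p' = 0 := fun p p' s => by
    simp only [segPoint_apply, lineConst]
    ring
  have e1 := key p p' s
  have e2 := key q q' t
  have e3 := key r r' u
  rw [h, h'] at e1
  rw [h'] at e2
  rw [lineDet]
  linear_combination ((q' 1 - q 1) * (r 0 - r' 0) - (r' 1 - r 1) * (q 0 - q' 0)) * e1 -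
    ((p' 1 - p 1) * (r 0 - r' 0) - (r' 1 - r 1) * (p 0 - p' 0)) * e2 +
    ((p' 1 - p 1) * (q 0 - q' 0) - (q' 1 - q 1) * (p 0 - p' 0)) * e3

/-- A family of points in the plane is generic if no three of them are collinear, and no three of
the lines spanned by pairwise disjoint pairs of them are concurrent. -/
structure IsGeneric {J : Type*} (q : J → EuclideanSpace ℝ (Fin 2)) : Prop where
  orient_ne_zero : ∀ t : Fin 3 → J, Function.Injective t →
    planeOrient (q (t 0)) (q (t 1)) (q (t 2)) ≠ 0
  lineDet_ne_zero : ∀ t : Fin 6 → J, Function.Injective t →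
    lineDet (q (t 0)) (q (t 1)) (q (t 2)) (q (t 3)) (q (t 4)) (q (t 5)) ≠ 0

/-- By the identity theorem, an analytic function vanishing on a nonempty open set vanishes
everywhere. -/
theorem isOpen_dense_ne_zero {V : Type*} [NormedAddCommGroup V] [NormedSpace ℝ V] {f : V → ℝ}
    (hf : ∀ v, AnalyticAt ℝ f v) (hne : ∃ v, f v ≠ 0) :
    IsOpen {v | f v ≠ 0} ∧ Dense {v | f v ≠ 0} := by
  have hc : Continuous f := continuous_iff_continuousAt.2 fun v => (hf v).continuousAt
  refine ⟨isOpen_ne_fun hc continuous_const, ?_⟩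
  obtain ⟨w, hw⟩ := hne
  rw [← compl_ofPred, ← interior_eq_empty_iff_dense_compl, eq_empty_iff_forall_notMem]
  intro v hv
  have hz : f =ᶠ[𝓝 v] 0 := mem_interior_iff_mem_nhds.1 hv
  have hf' : AnalyticOnNhd ℝ f univ := fun v _ => hf v
  exact hw (hf'.eqOn_zero_of_preconnected_of_eventuallyEq_zero isPreconnected_univ (mem_univ v) hz
    (mem_univ w))

/-- Generic families are dense. -/
theorem exists_isGeneric_near {J : Type*} [Fintype J] (q : J → EuclideanSpace ℝ (Fin 2)) {ε : ℝ}
    (hε : 0 < ε) : ∃ q' : J → EuclideanSpace ℝ (Fin 2), IsGeneric q' ∧ ∀ j, ‖q' j - q j‖ < ε := by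
  classical
  have hcoord : ∀ (j : J) (k : Fin 2) (v : J → EuclideanSpace ℝ (Fin 2)),
      AnalyticAt ℝ (fun q : J → EuclideanSpace ℝ (Fin 2) => q j k) v := fun j k v =>
    ((EuclideanSpace.proj (𝕜 := ℝ) k).comp
      (ContinuousLinearMap.proj (R := ℝ) (φ := fun _ : J => EuclideanSpace ℝ (Fin 2)) j)).analyticAt v
  have h3 : ∀ t : {t : Fin 3 → J // Function.Injective t}, _ := fun t =>
    isOpen_dense_ne_zero (V := J → EuclideanSpace ℝ (Fin 2))
      (f := fun q => planeOrient (q (t.1 0)) (q (t.1 1)) (q (t.1 2)))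
      (fun v => by
        have h := fun j k => hcoord j k v
        unfold planeOrient
        fun_prop)
      ⟨fun j => if j = t.1 1 then !₂[1, 0] else if j = t.1 2 then !₂[0, 1] else !₂[0, 0], by
        have hne : ∀ i j : Fin 3, t.1 i = t.1 j ↔ i = j := fun i j => t.2.eq_iff
        simp [planeOrient, hne]⟩
  have h6 : ∀ t : {t : Fin 6 → J // Function.Injective t}, _ := fun t =>
    isOpen_dense_ne_zero (V := J → EuclideanSpace ℝ (Fin 2))
      (f := fun q => lineDet (q (t.1 0)) (q (t.1 1)) (q (t.1 2)) (q (t.1 3)) (q (t.1 4)) (q (t.1 5)))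
      (fun v => by
        have h := fun j k => hcoord j k v
        unfold lineDet lineConst
        fun_prop)
      -- The three lines are the two coordinate axes and `x + y = 1`, which are not concurrent.
      ⟨fun j => if j = t.1 1 ∨ j = t.1 4 then !₂[1, 0] else
          if j = t.1 3 ∨ j = t.1 5 then !₂[0, 1] else !₂[0, 0], by
        have hne : ∀ i j : Fin 6, t.1 i = t.1 j ↔ i = j := fun i j => t.2.eq_iff
        simp [lineDet, lineConst, hne]⟩
  have hd3 := dense_iInter_of_isOpen (fun t => (h3 t).1) fun t => (h3 t).2
  have hd6 := dense_iInter_of_isOpen (fun t => (h6 t).1) fun t => (h6 t).2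
  have ho3 := isOpen_iInter_of_finite fun t => (h3 t).1
  have hd := hd3.inter_of_isOpen_left hd6 ho3
  obtain ⟨q', hq', h1, h2⟩ := Metric.dense_iff.1 hd q ε hε
  refine ⟨q', ⟨fun t ht => mem_iInter.1 h1 ⟨t, ht⟩, fun t ht => mem_iInter.1 h2 ⟨t, ht⟩⟩,
    fun j => ?_⟩
  rw [← dist_eq_norm]
  exact (dist_le_pi_dist q' q j).trans_lt hq'

namespace IsGeneric

variable {J : Type*} {q : J → EuclideanSpace ℝ (Fin 2)}

theorem planeOrient_ne_zero (hq : IsGeneric q) {a b c : J} (hab : a ≠ b) (hbc : b ≠ c)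
    (hac : a ≠ c) : planeOrient (q a) (q b) (q c) ≠ 0 := by
  refine hq.orient_ne_zero ![a, b, c] fun i j hij => ?_
  fin_cases i <;> fin_cases j <;> simp_all

variable {nxt : J → J}

/-- Edges of generic polygons meet only in their interiors, except at common vertices, and those
that meet have four different vertices. -/
theorem of_segPoint_eq (hq : IsGeneric q) (h1 : ∀ a, nxt a ≠ a)
    (h2 : ∀ a, nxt (nxt a) ≠ a) {a b : J} {s t : ℝ} (hs : s ∈ Ico (0 : ℝ) 1)
    (ht : t ∈ Ico (0 : ℝ) 1) (hne : (a, s) ≠ (b, t))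
    (he : segPoint (q a) (q (nxt a)) s = segPoint (q b) (q (nxt b)) t) :
    s ≠ 0 ∧ t ≠ 0 ∧ a ≠ b ∧ nxt a ≠ b ∧ nxt b ≠ a := by
  have hab : a ≠ b := by
    rintro rfl
    have hst : s - t ≠ 0 := sub_ne_zero.2 fun h => hne (by rw [h])
    refine hq.planeOrient_ne_zero (h1 a).symm (h1 (nxt a)).symm (h2 a).symm
      ((mul_eq_zero.1 (?_ : (s - t) * _ = 0)).resolve_left hst)
    have e0 := congrArg (fun v : EuclideanSpace ℝ (Fin 2) => v 0) he
    have e1 := congrArg (fun v : EuclideanSpace ℝ (Fin 2) => v 1) he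
    simp only [segPoint_apply] at e0 e1
    rw [planeOrient]
    linear_combination (q (nxt (nxt a)) 1 - q a 1) * e0 - (q (nxt (nxt a)) 0 - q a 0) * e1
  -- Consecutive edges meeting away from their common vertex would make three successive vertices
  -- collinear.
  have hcons : ∀ {a : J} {s t : ℝ}, s ∈ Ico (0 : ℝ) 1 →
      segPoint (q a) (q (nxt a)) s ≠ segPoint (q (nxt a)) (q (nxt (nxt a))) t := by
    intro a s t hs he
    exact mul_ne_zero (by linarith [hs.2])
      (hq.planeOrient_ne_zero (h1 a).symm (h1 (nxt a)).symm (h2 a).symm)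
      (planeOrient_mul_eq_zero he)
  have hvert : ∀ {a b : J} {t : ℝ}, a ≠ b → nxt b ≠ a →
      segPoint (q a) (q (nxt a)) 0 ≠ segPoint (q b) (q (nxt b)) t := by
    intro a b t hab hba he
    have : segPoint (q a) (q b) 0 = segPoint (q b) (q (nxt b)) t := by
      rw [← he]
      simp [segPoint]
    refine mul_ne_zero ?_ (hq.planeOrient_ne_zero hab (h1 b).symm hba.symm)
      (planeOrient_mul_eq_zero this)
    norm_num
  have hna : nxt a ≠ b := by
    rintro rfl
    exact hcons hs he
  have hnb : nxt b ≠ a := by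
    rintro rfl
    exact hcons ht he.symm
  refine ⟨?_, ?_, hab, hna, hnb⟩
  · rintro rfl
    exact hvert hab hnb he
  · rintro rfl
    exact hvert hab.symm hna he.symm

/-- If the edges were parallel, a common point would put them on one line, making `a`, `b` and `nxt
b` collinear. Otherwise their lines meet only once. -/
theorem segPoint_unique (hq : IsGeneric q) (h1 : ∀ a, nxt a ≠ a) {a b : J} (hab : a ≠ b)
    (hba : nxt b ≠ a) {s t s' t' : ℝ}
    (he : segPoint (q a) (q (nxt a)) s = segPoint (q b) (q (nxt b)) t)
    (he' : segPoint (q a) (q (nxt a)) s' = segPoint (q b) (q (nxt b)) t') : s = s' ∧ t = t' := by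
  have ho := hq.planeOrient_ne_zero hab (h1 b).symm hba.symm
  have e0 := congrArg (fun v : EuclideanSpace ℝ (Fin 2) => v 0) he
  have e1 := congrArg (fun v : EuclideanSpace ℝ (Fin 2) => v 1) he
  have f0 := congrArg (fun v : EuclideanSpace ℝ (Fin 2) => v 0) he'
  have f1 := congrArg (fun v : EuclideanSpace ℝ (Fin 2) => v 1) he'
  simp only [segPoint_apply] at e0 e1 f0 f1
  set w := (q (nxt a) 0 - q a 0) * (q (nxt b) 1 - q b 1) -
    (q (nxt a) 1 - q a 1) * (q (nxt b) 0 - q b 0) with hw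
  have hw0 : w ≠ 0 := by
    intro h0
    apply ho
    rw [planeOrient]
    linear_combination -(q (nxt b) 1 - q b 1) * e0 + (q (nxt b) 0 - q b 0) * e1 + s * h0
  constructor
  · refine sub_eq_zero.1 ((mul_eq_zero.1 (?_ : (s - s') * w = 0)).resolve_right hw0)
    rw [hw]
    linear_combination (q (nxt b) 1 - q b 1) * (e0 - f0) - (q (nxt b) 0 - q b 0) * (e1 - f1)
  · refine sub_eq_zero.1 ((mul_eq_zero.1 (?_ : (t - t') * w = 0)).resolve_right hw0)
    rw [hw]
    linear_combination (q (nxt a) 1 - q a 1) * (e0 - f0) - (q (nxt a) 0 - q a 0) * (e1 - f1)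

/-- Edges that meet share no vertex, so three edges through one point have six distinct vertices,
and the determinant condition applies. -/
theorem not_concurrent (hq : IsGeneric q) (hinj : Function.Injective nxt) (h1 : ∀ a, nxt a ≠ a)
    (h2 : ∀ a, nxt (nxt a) ≠ a) {a b c : J} {s t u : ℝ} (hs : s ∈ Ico (0 : ℝ) 1)
    (ht : t ∈ Ico (0 : ℝ) 1) (hu : u ∈ Ico (0 : ℝ) 1) (hst : (a, s) ≠ (b, t))
    (htu : (b, t) ≠ (c, u)) (hsu : (a, s) ≠ (c, u))
    (he : segPoint (q a) (q (nxt a)) s = segPoint (q b) (q (nxt b)) t) :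
    segPoint (q b) (q (nxt b)) t ≠ segPoint (q c) (q (nxt c)) u := by
  intro he'
  obtain ⟨-, -, a1, a2, a3⟩ := hq.of_segPoint_eq h1 h2 hs ht hst he
  obtain ⟨-, -, b1, b2, b3⟩ := hq.of_segPoint_eq h1 h2 ht hu htu he'
  obtain ⟨-, -, c1, c2, c3⟩ := hq.of_segPoint_eq h1 h2 hs hu hsu (he.trans he')
  have n1 := hinj.ne a1
  have n2 := hinj.ne b1
  have n3 := hinj.ne c1
  have k1 := h1 a
  have k2 := h1 b
  have k3 := h1 c
  refine hq.lineDet_ne_zero ![a, nxt a, b, nxt b, c, nxt c] (fun i j hij => ?_)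
    (lineDet_eq_zero he he')
  fin_cases i <;> fin_cases j <;> simp_all [eq_comm]

end IsGeneric

/-! ### Diagrams of tame links -/

theorem norm_spacePoint_zero (p : EuclideanSpace ℝ (Fin 2)) : ‖spacePoint p 0‖ = ‖p‖ := by
  simp [EuclideanSpace.norm_eq, Fin.sum_univ_three, Fin.sum_univ_two, spacePoint]

/-- A small horizontal displacement of the vertices of a polygonal link is an isotopy. -/
theorem Link.exists_isotopic_displacement {ι : Type} [Fintype ι] (P : Link ι)
    {c : ι → UnitAddCircle → E3} {m : ι → ℕ} (hpoly : ∀ i, IsPolygon (c i) (m i))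
    (hP : ∀ i x, P.toFun i x = (c i x : S3)) :
    ∃ ε : ℝ, 0 < ε ∧ ∀ d : (Σ i, Fin (m i)) → EuclideanSpace ℝ (Fin 2), (∀ a, ‖d a‖ < ε) →
      ∃ P' : Link ι, P.Isotopic P' ∧ ∀ i x, P'.toFun i x = (spacePoint (planeProj (c i x) +
        ∑ k : Fin (m i), circleHat (m i) k x • d ⟨i, k⟩) (c i x 2) : S3) := by
  classical
  let _ : TopologicalSpace ι := ⊥
  have _ : DiscreteTopology ι := ⟨rfl⟩
  let c' : ι × UnitAddCircle → E3 := fun p => c p.1 p.2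
  have hinj : Function.Injective c' := fun p p' h => P.injective_toFun <| by
    simp only [hP]
    exact congrArg OnePoint.some h
  have hinj' : ∀ i, Function.Injective (c i) := fun i x y h =>
    (Prod.ext_iff.1 (hinj (a₁ := (i, x)) (a₂ := (i, y)) h)).2
  have hc' : Continuous c' := continuous_prod_of_discrete_left.2 fun i => by
    rw [OnePoint.isOpenEmbedding_coe.isInducing.continuous_iff]
    exact (P.continuous_toFun i).congr (hP i)
  let φ : (Σ i, Fin (m i)) → ι × UnitAddCircle → ℝ := fun a p =>
    if p.1 = a.1 then circleHat (m a.1) a.2 p.2 else 0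
  have hφ : ∀ a, Continuous (φ a) := fun a => continuous_prod_of_discrete_left.2 fun i => by
    by_cases hi : i = a.1
    · simpa only [φ, if_pos hi] using continuous_circleHat _ _
    · simpa only [φ, if_neg hi] using continuous_const
  -- The hat function of each vertex is Lipschitz for the distance in space because the polygon is
  -- locally bi-Lipschitz; hence it extends to all of space.
  have hex : ∀ a, ∃ C : NNReal, ∃ ψ : E3 → ℝ, LipschitzWith C ψ ∧ ∀ p, ψ (c' p) = φ a p := by
    intro a
    obtain ⟨C, hC, h⟩ := exists_dist_bound_of_locally hc' hinj (hφ a) fun p => by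
      obtain ⟨U, hU, κ, hκ, h⟩ := (hpoly p.1).exists_local_antilipschitz (hinj' p.1) p.2
      refine ⟨{p.1} ×ˢ U, prod_mem_nhds (by simp) hU, (m a.1 : ℝ) / κ, ?_⟩
      rintro ⟨i, x⟩ ⟨hi, hx⟩ ⟨j, y⟩ ⟨hj, hy⟩
      obtain rfl : i = p.1 := hi
      obtain rfl : j = p.1 := hj
      have h1 : |φ a (p.1, x) - φ a (p.1, y)| ≤ m a.1 * ‖x - y‖ := by
        by_cases hi : p.1 = a.1
        · simpa only [φ, if_pos hi] using abs_circleHat_sub_le _ _ x y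
        · simp only [φ, if_neg hi, sub_zero, abs_zero]
          positivity
      refine h1.trans ?_
      rw [dist_eq_norm, div_mul_eq_mul_div, le_div_iff₀ hκ, mul_assoc, mul_comm _ κ]
      have := h x hx y hy
      gcongr
    obtain ⟨ψ, hψ, h⟩ := exists_lipschitz_extension hinj hC h
    exact ⟨_, ψ, hψ, h⟩
  choose C ψ hψ hψφ using hex
  have hS : (0 : ℝ) ≤ ∑ a, (C a : ℝ) := Finset.sum_nonneg fun a _ => (C a).2
  -- With this bound on the displacements, the total Lipschitz constant is at most `S / (S + 1) <
  -- 1`, where `S` is the sum of the `C a`.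
  refine ⟨1 / (∑ a, (C a : ℝ) + 1), by positivity, fun d hd => ?_⟩
  let δ : E3 → E3 := fun v => ∑ a, ψ a v • spacePoint (d a) 0
  have hδ : LipschitzWith (∑ a, C a * ‖d a‖₊) δ := by
    refine LipschitzWith.of_dist_le_mul fun v w => ?_
    rw [dist_eq_norm, ← Finset.sum_sub_distrib, NNReal.coe_sum, Finset.sum_mul]
    refine norm_sum_le_of_le _ fun a _ => ?_
    rw [← sub_smul, norm_smul, norm_spacePoint_zero, NNReal.coe_mul, coe_nnnorm,
      ← dist_eq_norm, mul_right_comm]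
    gcongr
    exact (hψ a).dist_le_mul v w
  have hlt : ∑ a, C a * ‖d a‖₊ < 1 := by
    rw [← NNReal.coe_lt_coe, NNReal.coe_sum]
    calc ∑ a, ((C a * ‖d a‖₊ : NNReal) : ℝ)
        ≤ ∑ a, (C a : ℝ) * (1 / (∑ a, (C a : ℝ) + 1)) := by
          refine Finset.sum_le_sum fun a _ => ?_
          rw [NNReal.coe_mul, coe_nnnorm]
          exact mul_le_mul_of_nonneg_left (hd a).le (C a).2
      _ = (∑ a, (C a : ℝ)) / (∑ a, (C a : ℝ) + 1) := by rw [← Finset.sum_mul, mul_one_div]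
      _ < 1 := by rw [div_lt_one (by positivity)]; exact lt_add_one _
  obtain ⟨H, h1, h2, h3⟩ := exists_isotopy_of_lipschitz hlt hδ
  refine ⟨_, P.isotopic_map H h1 h2 fun x => by simp [h3], fun i x => ?_⟩
  change (H 1).onePointCongr (P.toFun i x) = _
  rw [hP]
  refine congrArg OnePoint.some ((h3 1 (c i x)).trans ?_)
  have hsum : δ (c i x) = ∑ k : Fin (m i), circleHat (m i) k x • spacePoint (d ⟨i, k⟩) 0 := by
    have e : ∀ a, ψ a (c i x) = φ a (i, x) := fun a => hψφ a (i, x)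
    simp only [δ, e]
    rw [Fintype.sum_sigma, Finset.sum_eq_single i]
    · simp [φ]
    · intro j _ hj
      simp [φ, hj.symm]
    · simp
  rw [hsum]
  ext k
  fin_cases k <;> simp [spacePoint, planeProj]

/-- Generic closed polygons in the plane, with heights which distinguish the strands over each
double point, are the curves of a link diagram. -/
theorem Diagram.exists_of_isGeneric {ι : Type} [Finite ι]
    {γ : ι → UnitAddCircle → EuclideanSpace ℝ (Fin 2)} (z : ι → UnitAddCircle → ℝ) {m : ι → ℕ}
    (hcont : ∀ i, Continuous (γ i)) (hpoly : ∀ i, IsPolygon (γ i) (m i)) (hm : ∀ i, 3 ≤ m i)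
    (hgen : IsGeneric fun a : Σ i, Fin (m i) =>
      γ a.1 ((((a.2 : ℕ) : ℝ) / m a.1 : ℝ) : UnitAddCircle))
    (hz : ∀ a b : ι × UnitAddCircle, a ≠ b → γ a.1 a.2 = γ b.1 b.2 → z a.1 a.2 ≠ z b.1 b.2) :
    ∃ D : Diagram ι, D.curve = γ ∧ ∀ c ∈ D.crossings, z c.2.1 c.2.2 < z c.1.1 c.1.2 := by
  have hm0 : ∀ i, 0 < m i := fun i => by have := hm i; omega
  set q := fun a : Σ i, Fin (m i) => γ a.1 ((((a.2 : ℕ) : ℝ) / m a.1 : ℝ) : UnitAddCircle) with hq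
  let nxt : (Σ i, Fin (m i)) → Σ i, Fin (m i) := fun a =>
    ⟨a.1, ⟨(a.2 + 1) % m a.1, Nat.mod_lt _ (hm0 _)⟩⟩
  let pt : (Σ i, Fin (m i)) × ℝ → ι × UnitAddCircle := fun a =>
    (a.1.1, (((((a.1.2 : ℕ) : ℝ) + a.2) / m a.1.1 : ℝ) : UnitAddCircle))
  have hmod : ∀ {k n : ℕ}, k < n → (k + 1 < n ∧ (k + 1) % n = k + 1) ∨
      (k + 1 = n ∧ (k + 1) % n = 0) := fun {k n} h => by
    rcases (by omega : k + 1 < n ∨ k + 1 = n) with h' | h'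
    · exact Or.inl ⟨h', Nat.mod_eq_of_lt h'⟩
    · exact Or.inr ⟨h', by rw [h', Nat.mod_self]⟩
  have hinj : Function.Injective nxt := by
    rintro ⟨i, k, hk⟩ ⟨j, l, hl⟩ h
    obtain rfl : i = j := congrArg Sigma.fst h
    simp only [nxt, Sigma.mk.injEq, heq_eq_eq, true_and, Fin.mk.injEq] at h ⊢
    have := hmod hk
    have := hmod hl
    omega
  have h1 : ∀ a, nxt a ≠ a := by
    rintro ⟨i, k, hk⟩ h
    simp only [nxt, Sigma.mk.injEq, heq_eq_eq, true_and, Fin.mk.injEq] at h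
    have := hmod hk
    have := hm i
    omega
  have h2 : ∀ a, nxt (nxt a) ≠ a := by
    rintro ⟨i, k, hk⟩ h
    simp only [nxt, Sigma.mk.injEq, heq_eq_eq, true_and, Fin.mk.injEq] at h
    have := hmod hk
    have := hmod (Nat.mod_lt (k + 1) (hm0 i))
    have := hm i
    omega
  have hpt : ∀ p, ∃ a s, s ∈ Ico (0 : ℝ) 1 ∧ p = pt (a, s) := by
    rintro ⟨i, x⟩
    obtain ⟨k, hk, s, hs, rfl⟩ := UnitAddCircle.exists_nat_add_div (hm0 i) x
    exact ⟨⟨i, k, hk⟩, s, hs, rfl⟩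
  have hseg : ∀ a, ∀ s ∈ Ico (0 : ℝ) 1,
      γ (pt (a, s)).1 (pt (a, s)).2 = segPoint (q a) (q (nxt a)) s := fun a s hs => by
    have h := (hpoly a.1).2 a.2 s ⟨hs.1, hs.2.le⟩
    have e := UnitAddCircle.coe_mod_add_div (hm0 a.1) (a.2 + 1) 0
    rw [add_zero, add_zero, Nat.cast_add, Nat.cast_one] at e
    rw [← e] at h
    exact h
  have hdouble : ∀ {a b : Σ i, Fin (m i)} {s t : ℝ}, s ∈ Ico (0 : ℝ) 1 → t ∈ Ico (0 : ℝ) 1 →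
      pt (a, s) ≠ pt (b, t) → γ (pt (a, s)).1 (pt (a, s)).2 = γ (pt (b, t)).1 (pt (b, t)).2 →
      s ≠ 0 ∧ t ≠ 0 ∧ a ≠ b ∧ nxt a ≠ b ∧ nxt b ≠ a := fun {a b s t} hs ht hne he =>
    hgen.of_segPoint_eq h1 h2 hs ht (fun h => hne (by rw [h]))
      (by rwa [hseg a s hs, hseg b t ht] at he)
  have hvert : ∀ (p p' : ι × UnitAddCircle), p ≠ p' → γ p.1 p.2 = γ p'.1 p'.2 → ∀ j : ℕ,
      p.2 ≠ (((j : ℝ) / m p.1 : ℝ) : UnitAddCircle) := by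
    rintro ⟨i, x⟩ p' hne he j hj
    obtain ⟨b, t, ht, rfl⟩ := hpt p'
    have e := UnitAddCircle.coe_mod_add_div (hm0 i) j 0
    rw [add_zero, add_zero] at e
    have hx : (i, x) = pt (⟨i, j % m i, Nat.mod_lt _ (hm0 i)⟩, 0) := by
      simp only [pt, add_zero]
      rw [e]
      exact Prod.ext rfl hj
    rw [hx] at hne he
    exact (hdouble (by simp) ht hne he).1 rfl
  let X : Set ((ι × UnitAddCircle) × (ι × UnitAddCircle)) :=
    {c | γ c.1.1 c.1.2 = γ c.2.1 c.2.2 ∧ z c.2.1 c.2.2 < z c.1.1 c.1.2}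
  have hXne : ∀ c ∈ X, c.1 ≠ c.2 := fun c hc h => by
    have := hc.2
    rw [h] at this
    exact lt_irrefl _ this
  -- There are finitely many ordered pairs of edges, and each carries at most one crossing.
  have hfin : X.Finite := by
    refine (finite_iUnion (ι := (Σ i, Fin (m i)) × Σ i, Fin (m i)) (f := fun e =>
      {c | c ∈ X ∧ ∃ s ∈ Ico (0 : ℝ) 1, ∃ t ∈ Ico (0 : ℝ) 1, c = (pt (e.1, s), pt (e.2, t))})
      fun e => Set.Subsingleton.finite ?_).subset fun c hc => ?_
    · rintro _ ⟨hc, s, hs, t, ht, rfl⟩ _ ⟨hc', s', hs', t', ht', rfl⟩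
      obtain ⟨-, -, h3, -, h5⟩ := hdouble hs ht (hXne _ hc) hc.1
      have e1 := hc.1
      have e2 := hc'.1
      simp only [hseg _ _ hs, hseg _ _ ht, hseg _ _ hs', hseg _ _ ht'] at e1 e2
      obtain ⟨rfl, rfl⟩ := hgen.segPoint_unique h1 h3 h5 e1 e2
      rfl
    · obtain ⟨a, s, hs, ha⟩ := hpt c.1
      obtain ⟨b, t, ht, hb⟩ := hpt c.2
      exact mem_iUnion.2 ⟨(a, b), hc, s, hs, t, ht, Prod.ext ha hb⟩
  refine ⟨{ curve := γ
            edges := m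
            crossings := X
            continuous_curve := hcont
            polygon := hpoly
            finite_crossings := hfin
            double_point := fun a b => ?_
            asymm := fun a b h h' => lt_asymm h.2 h'.2
            no_triple_point := fun a b c hab hbc => ?_
            not_vertex := fun c hc j => ⟨hvert _ _ (hXne c hc) hc.1 j,
              hvert _ _ (hXne c hc).symm hc.1.symm j⟩ }, rfl, fun c hc => hc.2⟩
  · constructor
    · rintro ⟨hne, he⟩
      rcases (hz a b hne he).lt_or_gt with h | h
      · exact Or.inr ⟨he.symm, h⟩
      · exact Or.inl ⟨he, h⟩
    · rintro (h | h)
      · exact ⟨hXne _ h, h.1⟩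
      · exact ⟨(hXne _ h).symm, h.1.symm⟩
  · by_contra! hne
    obtain ⟨a, s, hs, rfl⟩ := hpt a
    obtain ⟨b, t, ht, rfl⟩ := hpt b
    obtain ⟨c, u, hu, rfl⟩ := hpt c
    have e1 := hab
    have e2 := hbc
    simp only [hseg _ _ hs, hseg _ _ ht, hseg _ _ hu] at e1 e2
    exact hgen.not_concurrent hinj h1 h2 hs ht hu (fun h => hne.1 (by rw [h]))
      (fun h => hne.2.1 (by rw [h])) (fun h => hne.2.2 (by rw [h])) e1 e2

/-- The projection of space to the plane, as a linear map. -/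
def planeProjLinear : E3 →ₗ[ℝ] EuclideanSpace ℝ (Fin 2) where
  toFun := planeProj
  map_add' v w := by
    ext k
    fin_cases k <;> simp [planeProj]
  map_smul' r v := by
    ext k
    fin_cases k <;> simp [planeProj]

/-- A tame link has a diagram. -/
theorem Link.exists_diagram {ι : Type} [Finite ι] (L : Link ι) (hL : L.IsTame) :
    ∃ D : Diagram ι, D.IsDiagramOf L := by
  classical
  have _ := Fintype.ofFinite ι
  obtain ⟨P, hLP, hP⟩ := hL
  choose c m hpoly hP using hP
  obtain ⟨ε, hε, hdisp⟩ := P.exists_isotopic_displacement hpoly hP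
  have hc : ∀ i, Continuous (c i) := fun i => by
    rw [OnePoint.isOpenEmbedding_coe.isInducing.continuous_iff]
    exact (P.continuous_toFun i).congr (hP i)
  have hinj : ∀ i, Function.Injective (c i) := fun i x y h => by
    refine (Prod.ext_iff.1 (P.injective_toFun (a₁ := (i, x)) (a₂ := (i, y)) ?_)).2
    simp only [hP, h]
  have hm : ∀ i, 3 ≤ m i := fun i => (hpoly i).three_le (hinj i)
  have hm2 : ∀ i, 2 ≤ m i := fun i => by have := hm i; omega
  let q : (Σ i, Fin (m i)) → EuclideanSpace ℝ (Fin 2) := fun a =>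
    planeProj (c a.1 ((((a.2 : ℕ) : ℝ) / m a.1 : ℝ) : UnitAddCircle))
  obtain ⟨q', hgen, hnear⟩ := exists_isGeneric_near q hε
  let d : (Σ i, Fin (m i)) → EuclideanSpace ℝ (Fin 2) := fun a => q' a - q a
  obtain ⟨P', hPP', hP'⟩ := hdisp d hnear
  let γ : ι → UnitAddCircle → EuclideanSpace ℝ (Fin 2) := fun i x =>
    planeProj (c i x) + ∑ k : Fin (m i), circleHat (m i) k x • d ⟨i, k⟩
  have hγcont : ∀ i, Continuous (γ i) := fun i => by
    have h := hc i
    have h' := continuous_planeProj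
    have h'' := fun k => continuous_circleHat (m i) k
    fun_prop
  have hγpoly : ∀ i, IsPolygon (γ i) (m i) := fun i =>
    ((hpoly i).map planeProjLinear).add (IsPolygon.sum _ (hpoly i).1 fun k : Fin (m i) =>
      (isPolygon_circleHat (hm2 i) k.2).map (LinearMap.toSpanSingleton ℝ _ (d ⟨i, k⟩)))
  have hvert : (fun a : Σ i, Fin (m i) =>
      γ a.1 ((((a.2 : ℕ) : ℝ) / m a.1 : ℝ) : UnitAddCircle)) = q' := by
    funext ⟨i, k⟩
    have h : ∀ l : Fin (m i), circleHat (m i) l ((((k : ℕ) : ℝ) / m i : ℝ) : UnitAddCircle) =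
        if k = l then 1 else 0 := fun l => by
      rw [circleHat_vertex (hm2 i) l.2 k.2]
      simp only [Fin.ext_iff]
    simp only [γ, h]
    simp [d, q]
  -- The displacement was horizontal, so the old heights still serve; they differ over double points
  -- because `P'` is embedded.
  obtain ⟨D, hcurve, hD⟩ := Diagram.exists_of_isGeneric (fun i x => c i x 2) hγcont hγpoly hm
    (by rw [hvert]; exact hgen) fun a b hne he he' => hne (P'.injective_toFun (by
      simp only [hP']
      change ((spacePoint (γ a.1 a.2) _ : E3) : S3) = (spacePoint (γ b.1 b.2) _ : E3)
      rw [he, he']))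
  refine ⟨D, Isotopic.trans ?_ (hLP.trans hPP').symm⟩
  -- The heights chosen for `D.link` and those of `P'` order the strands alike, so a vertical
  -- isotopy relates the two links.
  obtain ⟨lam, phi, h1, h2, h3, h4⟩ := D.exists_vertical_affine univ D.height (fun i x => c i x 2)
    D.continuous_height (fun i => by have h := hc i; fun_prop) fun e he _ _ => by
      have e1 := D.height_lt he
      have e2 := hD e he
      exact mul_pos (by linarith) (by linarith)
  convert D.link.isotopic_map_verticalHomeo lam phi h1 h2 h3 using 1
  have hfun : P'.toFun = (D.link.map (verticalHomeo lam phi h1 h2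
      fun p => (h3 p).ne').onePointCongr).toFun := by
    funext i x
    rw [hP']
    refine congrArg OnePoint.some (Eq.symm ((verticalHomeo_spacePoint lam phi h1 h2
      (fun p => (h3 p).ne') (D.curve i x) (D.height i x)).trans ?_))
    rw [← h4 i (mem_univ i) x, hcurve]
  cases P'
  exact (Link.mk.injEq ..).mpr hfun

/-! ### The main theorem -/

theorem theorem1 (n : ℕ) (hn : 1 ≤ n) (L : Link (Fin n)) (hL : L.IsTame) (hB : L.IsBrunnian) :
    L.IsNTrivial (n - 1) ∧
    ∀ D : Diagram (Fin n), D.IsDiagramOf L →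
      ∀ T : Set (Fin n), T.Nonempty → T ≠ univ →
        ∀ D' : Diagram (Fin n), D' = D.change (⋃ i ∈ T, D.underCrossings i) →
          (∀ c ∈ D'.crossings, c.2.1 ∈ T → c.1.1 ∈ T) ∧
          D'.link.IsSplit T ∧
          (D'.link.sub T).IsTrivial ∧ (D'.link.sub Tᶜ).IsTrivial ∧
          D'.link.IsTrivial := by
  have main : ∀ D : Diagram (Fin n), D.IsDiagramOf L →
      ∀ T : Set (Fin n), T.Nonempty → T ≠ univ →
        ∀ D' : Diagram (Fin n), D' = D.change (⋃ i ∈ T, D.underCrossings i) →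
          (∀ c ∈ D'.crossings, c.2.1 ∈ T → c.1.1 ∈ T) ∧
          D'.link.IsSplit T ∧
          (D'.link.sub T).IsTrivial ∧ (D'.link.sub Tᶜ).IsTrivial ∧
          D'.link.IsTrivial := fun D hD T hne hT D' hD' =>
    D.change_under_isSplit_isTrivial T (hB.isTrivial_sub hD.symm hT)
      (hB.isTrivial_sub hD.symm (by simpa using hne.ne_empty)) hD'
  refine ⟨?_, main⟩
  obtain ⟨D, hD⟩ := L.exists_diagram hL
  have hcast : (n - 1) + 1 = n := Nat.sub_add_cancel hn
  -- The last component is left out, so the image of any `T` is a proper subset.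
  let f : Fin (n - 1) → Fin n := fun j => Fin.cast hcast j.castSucc
  have hf : Function.Injective f :=
    (Fin.cast_injective hcast).comp (Fin.castSucc_injective (n - 1))
  refine ⟨D, hD, fun j => D.underCrossings (f j), fun j c hc => hc.1, fun j l hjl => ?_,
    fun T hT => ?_⟩
  · change Disjoint _ _
    rw [Set.disjoint_left]
    rintro c ⟨-, hj⟩ ⟨-, hl⟩
    exact hjl (hf (hj.symm.trans hl))
  · have hne : f '' T ≠ univ := fun h => by
      obtain ⟨j, -, hj⟩ : Fin.cast hcast (Fin.last (n - 1)) ∈ f '' T := h ▸ mem_univ _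
      exact (Fin.castSucc_lt_last j).ne (Fin.cast_injective hcast hj)
    have := (main D hD (f '' T) (hT.image f) hne _ rfl).2.2.2.2
    rwa [biUnion_image] at this
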